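/- All digraphs are finite. A tournament is an orientation of a complete graph. For an acyclic digraph $G$, the oriented Ramsey number $\vec r(G)$ is the least $N$ such that every tournament on $N$ vertices contains a copy of $G$ as a (not necessarily induced) subdigraph. A graded partition of $G$ is a partition $V(G)=V_1\cup\dots\cup V_H$ into pairwise disjoint (possibly empty) sets such that every edge of $G$ is directed from $V_i$ to $V_{i+1}$ for some $1\le i\le H-1$; a digraph with a graded partition is acyclic. **Theorem.** Let $G$ be a digraph with at least one edge and with a graded partition $V(G)=V_1\cup\dots\cup V_H$, $H\in\mathbb N$, and let $\Delta^-$ and $\Delta^+$ be the maximum in-degree and the maximum out-degree of $G$. For $1\le i\le H-1$ let $\Delta_i^-$ be the maximum in-degree in the induced subgraph $G[V_i\cup V_{i+1}]$, and set $\Delta_0^-=\Delta_H^-=0$. Then $\vec r(G)$ is finite and $$\vec r(G)\;\le\; 10^9\,(\Delta^-)^2\,\Delta^+\sum_{i=1}^{H}2^{2(\Delta_{i-1}^-+\Delta_i^-)}\,|V_i| .$$ -/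

import Mathlib

namespace OrientedRamsey

/-- A tournament: an orientation of the complete graph, i.e. there are no loops, and between any two
distinct vertices there is an edge in exactly one of the two directions. -/
def IsTournament {W : Type*} (T : Digraph W) : Prop :=
  (∀ u, ¬ T.Adj u u) ∧ ∀ u v, u ≠ v → (T.Adj u v ↔ ¬ T.Adj v u)

/-- `T` contains a copy of `G` (as a not necessarily induced subdigraph). -/
def ContainsCopy {V W : Type*} (T : Digraph W) (G : Digraph V) : Prop :=
  ∃ φ : V → W, Function.Injective φ ∧ ∀ u v, G.Adj u v → T.Adj (φ u) (φ v)

/-- Every tournament on `N` vertices contains a copy of `G`. -/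
def ForcedBy {V : Type*} (G : Digraph V) (N : ℕ) : Prop :=
  ∀ T : Digraph (Fin N), IsTournament T → ContainsCopy T G

/-- The oriented Ramsey number of `G`: the least `N` such that every tournament on `N` vertices
contains a copy of `G`. It is `⊤` if there is no such `N`, so that a finite upper bound
includes the assertion that such an `N` exists. -/
noncomputable def orientedRamseyNumber {V : Type*} (G : Digraph V) : ℕ∞ :=
  ⨅ N ∈ {N : ℕ | ForcedBy G N}, (N : ℕ∞)

/-- The in-degree of `v` in a finite digraph. -/
noncomputable def inDegree {V : Type*} (G : Digraph V) (v : V) : ℕ :=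
  {u : V | G.Adj u v}.ncard

/-- The out-degree of `v` in a finite digraph. -/
noncomputable def outDegree {V : Type*} (G : Digraph V) (v : V) : ℕ :=
  {w : V | G.Adj v w}.ncard

/-- The maximum in-degree (`0` if there are no vertices). -/
noncomputable def maxInDegree {V : Type*} [Fintype V] (G : Digraph V) : ℕ :=
  Finset.univ.sup (inDegree G)

/-- The maximum out-degree (`0` if there are no vertices). -/
noncomputable def maxOutDegree {V : Type*} [Fintype V] (G : Digraph V) : ℕ :=
  Finset.univ.sup (outDegree G)

/-- The induced subdigraph `G[S]`. -/
def induced {V : Type*} (G : Digraph V) (S : Finset V) : Digraph S where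
  Adj u v := G.Adj u v

/-- `P 1, …, P H` is a graded partition of `G`: these sets are pairwise disjoint, they cover the
vertex set, and every edge goes from `P i` to `P (i + 1)` for some `1 ≤ i ≤ H - 1`.
The values of `P` outside `{1, …, H}` play no role. -/
structure IsGradedPartition {V : Type*} (G : Digraph V) (H : ℕ) (P : ℕ → Finset V) : Prop where
  disjoint : ∀ i ∈ Finset.Icc 1 H, ∀ j ∈ Finset.Icc 1 H, i ≠ j → Disjoint (P i) (P j)
  cover : ∀ v, ∃ i ∈ Finset.Icc 1 H, v ∈ P i
  edge : ∀ u v, G.Adj u v → ∃ i, 1 ≤ i ∧ i < H ∧ u ∈ P i ∧ v ∈ P (i + 1)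

/-- For `1 ≤ i ≤ H - 1`, the maximum in-degree of `G[P i ∪ P (i + 1)]`;
it is set to `0` for `i = 0` and for `i = H`. -/
noncomputable def layerMaxInDegree {V : Type*} [DecidableEq V] (G : Digraph V) (H : ℕ)
    (P : ℕ → Finset V) (i : ℕ) : ℕ :=
  if 1 ≤ i ∧ i < H then maxInDegree (induced G (P i ∪ P (i + 1))) else 0

end OrientedRamsey

/-! Take a median order of the tournament: at least half of every interval ending just before a
vertex v consists of in-neighbours of v. Going from right to left, one finds disjoint blocks, one
per layer, such that the edge density from the block for V_i to the set U_{i+1} already chosen is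
almost 1/2. Dependent random choice inside the block (`exists_subset_few_sparseTuples`) yields a
large U_i in which few tuples of size Δ_i^- are sparse, i.e. have a small common out-neighbourhood
in U_{i+1}. `IsMedianOrder.exists_chain` joins these steps.

The layers are then embedded from left to right, V_i into U_i
(`IsGradedPartition.exists_embedding`). The invariant is that every vertex of the next layer has
many candidates, namely common out-neighbours of its embedded in-neighbours. Images are chosen among
the candidates so that they are distinct and no vertex of V_{i+1} sees a sparse tuple. By the local
lemma (`exists_satisfying_assignment`) the sparse tuples need only be rare compared with 1/Δ^+,
since each vertex lies in at most Δ^+ of these constraints, whatever the size of the layer.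

With density near 1/2, a choice of t vertices shrinks a block by about 2^t;
`exists_choice_parameters` balances t against the sparsity required. Vertices without in-neighbours
have all of U_i as candidates and are cheap. The others number at most Δ^+ |V_{i-1}|, so part of
their cost is charged to the previous layer. This leads to the weights 2^{2(Δ_{i-1}^- + Δ_i^-)}. -/

namespace OrientedRamsey

/-! ### A counting version of the local lemma -/

section LocalLemma

open scoped Classical

variable {α β ι : Type*} [Fintype α]

/-- The assignments of values `f v ∈ C v` to the points of `X`, extended by `z` outside `X`. -/
noncomputable def assignments (C : α → Finset β) (z : β) (X : Finset α) : Finset (α → β) :=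
  Fintype.piFinset fun v => if v ∈ X then C v else {z}

/-- The assignments on the support `Y w` of the constraint `w` that violate it. -/
noncomputable def violating (C : α → Finset β) (z : β) (Y : ι → Finset α)
    (bad : ι → (α → β) → Prop) (w : ι) : Finset (α → β) :=
  (assignments C z (Y w)).filter (bad w)

/-- The assignments on `X` that satisfy every constraint supported in `X`. -/
noncomputable def satisfying (C : α → Finset β) (z : β) (s : Finset ι) (Y : ι → Finset α)
    (bad : ι → (α → β) → Prop) (X : Finset α) : Finset (α → β) :=
  (assignments C z X).filter fun f => ∀ w ∈ s, Y w ⊆ X → ¬ bad w f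

variable {C : α → Finset β} {z : β} {s : Finset ι} {Y : ι → Finset α}
  {bad : ι → (α → β) → Prop}

lemma mem_assignments {X : Finset α} {f : α → β} :
    f ∈ assignments C z X ↔ (∀ v ∈ X, f v ∈ C v) ∧ ∀ v ∉ X, f v = z := by
  simp only [assignments, Fintype.mem_piFinset]
  constructor
  · intro h
    refine ⟨fun v hv => ?_, fun v hv => ?_⟩
    · simpa [hv] using h v
    · simpa [hv] using h v
  · rintro ⟨h1, h2⟩ v
    by_cases hv : v ∈ X
    · simpa [hv] using h1 v hv
    · simpa [hv] using h2 v hv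

lemma piecewise_mem_assignments {X Z : Finset α} {f : α → β} (hf : f ∈ assignments C z X)
    (hZ : Z ⊆ X) : Z.piecewise f (fun _ => z) ∈ assignments C z Z := by
  rw [mem_assignments] at hf ⊢
  refine ⟨fun v hv => ?_, fun v hv => ?_⟩
  · rw [Finset.piecewise_eq_of_mem _ _ _ hv]; exact hf.1 v (hZ hv)
  · rw [Finset.piecewise_eq_of_notMem _ _ _ hv]

/-- An assignment is determined by its restrictions to `Y w` and to `X \ Y w`; the first violates
`w`, the second meets all constraints supported there. -/
lemma card_violating_extensions_le
    (hdep : ∀ w f g, (∀ v ∈ Y w, f v = g v) → bad w f → bad w g)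
    {X : Finset α} {w : ι} (hw : Y w ⊆ X) :
    ((assignments C z X).filter fun f =>
      bad w f ∧ ∀ w' ∈ s, Y w' ⊆ X \ Y w → ¬ bad w' f).card ≤
    (violating C z Y bad w).card * (satisfying C z s Y bad (X \ Y w)).card := by
  rw [← Finset.card_product]
  apply Finset.card_le_card_of_injOn
    (fun f => ((Y w).piecewise f (fun _ => z), (X \ Y w).piecewise f (fun _ => z)))
  · intro f hf
    simp only [Finset.coe_filter, Set.mem_ofPred_eq] at hf
    obtain ⟨hf, hb, hg⟩ := hf
    simp only [Finset.coe_product, Set.mem_prod, Finset.mem_coe, violating, satisfying,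
      Finset.mem_filter]
    refine ⟨⟨piecewise_mem_assignments hf hw, hdep w f _ (fun v hv => ?_) hb⟩,
      piecewise_mem_assignments hf Finset.sdiff_subset, fun w' hw' hY hb' => ?_⟩
    · rw [Finset.piecewise_eq_of_mem _ _ _ hv]
    · refine hg w' hw' hY (hdep w' _ f (fun v hv => ?_) hb')
      rw [Finset.piecewise_eq_of_mem _ _ _ (hY hv)]
  · intro f hf g hg hfg
    simp only [Finset.coe_filter, Set.mem_ofPred_eq, mem_assignments] at hf hg
    simp only [Prod.mk.injEq] at hfg
    funext v
    by_cases hvY : v ∈ Y w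
    · simpa [Finset.piecewise_eq_of_mem _ _ _ hvY] using congrFun hfg.1 v
    · by_cases hvX : v ∈ X
      · have : v ∈ X \ Y w := Finset.mem_sdiff.2 ⟨hvX, hvY⟩
        simpa only [Finset.piecewise_eq_of_mem _ _ _ this] using congrFun hfg.2 v
      · rw [hf.1.2 v hvX, hg.1.2 v hvX]

/-- Extend a satisfying assignment on `X` by any value at `v`. If the result breaks a constraint
`w`, then `v ∈ Y w`, while the constraints supported off `Y w` still hold, so
`card_violating_extensions_le` counts the failures. -/
lemma card_mul_card_satisfying_le
    (hdep : ∀ w f g, (∀ v ∈ Y w, f v = g v) → bad w f → bad w g)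
    {X : Finset α} {v : α} (hv : v ∉ X) :
    (C v).card * (satisfying C z s Y bad X).card ≤
    (satisfying C z s Y bad (insert v X)).card +
      ∑ w ∈ s.filter (fun w => v ∈ Y w ∧ Y w ⊆ insert v X),
        (violating C z Y bad w).card * (satisfying C z s Y bad (insert v X \ Y w)).card := by
  set E := (assignments C z (insert v X)).filter fun f => ∀ w ∈ s, Y w ⊆ X → ¬ bad w f
    with hE
  have h1 : (C v).card * (satisfying C z s Y bad X).card ≤ E.card := by
    rw [← Finset.card_product]
    apply Finset.card_le_card_of_injOn (fun p => Function.update p.2 v p.1)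
    · rintro ⟨c, f⟩ hp
      simp only [Finset.coe_product, Set.mem_prod, Finset.mem_coe, satisfying,
        Finset.mem_filter, mem_assignments] at hp
      simp only [hE, Finset.coe_filter, Set.mem_ofPred_eq, mem_assignments]
      obtain ⟨hc, ⟨hf1, hf2⟩, hf3⟩ := hp
      refine ⟨⟨fun u hu => ?_, fun u hu => ?_⟩, fun w hw hY hb => hf3 w hw hY ?_⟩
      · by_cases huv : u = v
        · subst huv; simpa using hc
        · rw [Function.update_of_ne huv]
          exact hf1 u ((Finset.mem_insert.1 hu).resolve_left huv)
      · rw [Finset.mem_insert, not_or] at hu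
        rw [Function.update_of_ne hu.1]
        exact hf2 u hu.2
      · refine hdep w _ f (fun u hu => ?_) hb
        rw [Function.update_of_ne]
        rintro rfl
        exact hv (hY hu)
    · rintro ⟨c, f⟩ hp ⟨c', f'⟩ hp' h
      simp only [Finset.coe_product, Set.mem_prod, Finset.mem_coe, satisfying,
        Finset.mem_filter, mem_assignments] at hp hp'
      simp only at h
      have hc : c = c' := by simpa using congrFun h v
      refine Prod.ext hc ?_
      funext u
      by_cases huv : u = v
      · subst huv
        change f u = f' u
        rw [hp.2.1.2 u hv, hp'.2.1.2 u hv]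
      · simpa [Function.update_of_ne huv] using congrFun h u
  have h2 : E ⊆ satisfying C z s Y bad (insert v X) ∪
      (s.filter (fun w => v ∈ Y w ∧ Y w ⊆ insert v X)).biUnion fun w =>
        (assignments C z (insert v X)).filter fun f =>
          bad w f ∧ ∀ w' ∈ s, Y w' ⊆ insert v X \ Y w → ¬ bad w' f := by
    intro f hf
    simp only [hE, Finset.mem_filter] at hf
    simp only [Finset.mem_union, satisfying, Finset.mem_biUnion, Finset.mem_filter]
    by_cases hall : ∀ w ∈ s, Y w ⊆ insert v X → ¬ bad w f
    · exact Or.inl ⟨hf.1, hall⟩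
    · push Not at hall
      obtain ⟨w, hw, hY, hb⟩ := hall
      have hvY : v ∈ Y w := by
        by_contra hvY
        exact hf.2 w hw ((Finset.subset_insert_iff_of_notMem hvY).1 hY) hb
      refine Or.inr ⟨w, ⟨hw, hvY, hY⟩, hf.1, hb, fun w' hw' hY' => hf.2 w' hw' ?_⟩
      intro u hu
      have := Finset.mem_sdiff.1 (hY' hu)
      rcases Finset.mem_insert.1 this.1 with h | h
      · subst h; exact absurd hvY this.2
      · exact h
  refine h1.trans ((Finset.card_le_card h2).trans ((Finset.card_union_le _ _).trans ?_))
  refine Nat.add_le_add_left (Finset.card_biUnion_le.trans (Finset.sum_le_sum fun w hw => ?_)) _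
  exact card_violating_extensions_le hdep (Finset.mem_filter.1 hw).2.2

/-- The points of `Z` are put back one at a time, each by `hgrow`. The restriction to fewer than `n`
points makes the bound usable inside the induction that proves `hgrow`. -/
lemma prod_mul_card_satisfying_le {n : ℕ}
    (hgrow : ∀ X : Finset α, X.card < n → ∀ v ∉ X, ((C v).card : ℝ) *
      (satisfying C z s Y bad X).card ≤ 2 * (satisfying C z s Y bad (insert v X)).card)
    (Z : Finset α) : ∀ X : Finset α, X.card ≤ n → Z ⊆ X →
      (∏ v ∈ Z, ((C v).card : ℝ)) * (satisfying C z s Y bad (X \ Z)).card ≤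
        2 ^ Z.card * (satisfying C z s Y bad X).card := by
  induction Z using Finset.induction_on with
  | empty => intro X _ _; simp
  | insert v Z hv ih =>
    intro X hX hZ
    have hvX : v ∈ X := hZ (Finset.mem_insert_self _ _)
    rw [Finset.prod_insert hv, Finset.card_insert_of_notMem hv]
    have hins : insert v (X \ insert v Z) = X \ Z := by
      ext u
      simp only [Finset.mem_insert, Finset.mem_sdiff, not_or]
      by_cases huv : u = v
      · subst huv; simp [hvX, hv]
      · simp [huv]
    have hcard : (X \ insert v Z).card < n := by
      refine lt_of_lt_of_le (Finset.card_lt_card ?_) hX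
      exact ⟨Finset.sdiff_subset, fun h => by
        have := h hvX
        simp at this⟩
    have h1 := hgrow (X \ insert v Z) hcard v (by simp)
    rw [hins] at h1
    have h2 := ih X hX ((Finset.subset_insert _ _).trans hZ)
    have hp : (0 : ℝ) ≤ ∏ v ∈ Z, ((C v).card : ℝ) :=
      Finset.prod_nonneg fun _ _ => Nat.cast_nonneg _
    calc _ = (∏ v ∈ Z, ((C v).card : ℝ)) * (((C v).card : ℝ) *
          (satisfying C z s Y bad (X \ insert v Z)).card) := by ring
      _ ≤ (∏ v ∈ Z, ((C v).card : ℝ)) * (2 * (satisfying C z s Y bad (X \ Z)).card) :=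
          mul_le_mul_of_nonneg_left h1 hp
      _ = 2 * ((∏ v ∈ Z, ((C v).card : ℝ)) * (satisfying C z s Y bad (X \ Z)).card) := by ring
      _ ≤ 2 * (2 ^ Z.card * (satisfying C z s Y bad X).card) := by gcongr
      _ = _ := by ring

/-- A counting form of the local lemma: a family of local constraints can be satisfied if, at every
point, the densities of the violating assignments sum up to little. -/
theorem exists_satisfying_assignment
    (hdep : ∀ w f g, (∀ v ∈ Y w, f v = g v) → bad w f → bad w g)
    (hY : ∀ w ∈ s, (Y w).Nonempty) (hC : ∀ v, (C v).Nonempty)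
    (hsum : ∀ v, ∑ w ∈ s.filter (fun w => v ∈ Y w),
      ((violating C z Y bad w).card : ℝ) / (∏ u ∈ Y w, ((C u).card : ℝ)) * 2 ^ (Y w).card ≤ 1) :
    ∃ f : α → β, (∀ v, f v ∈ C v) ∧ ∀ w ∈ s, ¬ bad w f := by
  have hCpos : ∀ v, (0 : ℝ) < (C v).card := fun v =>
    Nat.cast_pos.2 (hC v).card_pos
  have hgrow : ∀ n : ℕ, ∀ X : Finset α, X.card < n → ∀ v ∉ X, ((C v).card : ℝ) *
      (satisfying C z s Y bad X).card ≤ 2 * (satisfying C z s Y bad (insert v X)).card := by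
    intro n
    induction n with
    | zero => intro X hX; omega
    | succ n ih =>
      intro X hX v hv
      have hmain := card_mul_card_satisfying_le (C := C) (z := z) (s := s) hdep hv
      set N : ℝ := ((satisfying C z s Y bad X).card : ℝ) with hN
      -- Removing the points of `Y w` other than `v` costs a factor 2 each, hence 2 ^ (|Y w| - 1).
      -- The missing factor 2 becomes the 1/2 on the right, so at most half of the extensions to `v`
      -- are lost.
      have hterm : ∀ w ∈ s.filter (fun w => v ∈ Y w ∧ Y w ⊆ insert v X),
          ((violating C z Y bad w).card : ℝ) *
            (satisfying C z s Y bad (insert v X \ Y w)).card ≤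
          (((violating C z Y bad w).card : ℝ) / (∏ u ∈ Y w, ((C u).card : ℝ)) *
            2 ^ (Y w).card) * ((C v).card * N / 2) := by
        intro w hw
        obtain ⟨-, hvY, hYX⟩ := Finset.mem_filter.1 hw
        have hsub : (Y w).erase v ⊆ X := by
          intro u hu
          obtain ⟨h1, h2⟩ := Finset.mem_erase.1 hu
          exact (Finset.mem_insert.1 (hYX h2)).resolve_left h1
        have hsd : insert v X \ Y w = X \ (Y w).erase v := by
          ext u
          simp only [Finset.mem_sdiff, Finset.mem_insert, Finset.mem_erase]
          by_cases huv : u = v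
          · subst huv; simp [hvY, hv]
          · simp [huv]
        have h := prod_mul_card_satisfying_le ih ((Y w).erase v) X (by omega) hsub
        rw [← hsd, ← hN] at h
        have hprod : (∏ u ∈ Y w, ((C u).card : ℝ)) =
            (C v).card * ∏ u ∈ (Y w).erase v, ((C u).card : ℝ) :=
          (Finset.mul_prod_erase _ _ hvY).symm
        have hcard : (Y w).card = ((Y w).erase v).card + 1 :=
          (Finset.card_erase_add_one hvY).symm
        have hpp : (0 : ℝ) < ∏ u ∈ (Y w).erase v, ((C u).card : ℝ) := by
          refine Finset.prod_pos fun u _ => ?_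
          exact hCpos u
        have h' : ((satisfying C z s Y bad (insert v X \ Y w)).card : ℝ) ≤
            2 ^ ((Y w).erase v).card * N / ∏ u ∈ (Y w).erase v, ((C u).card : ℝ) := by
          rw [le_div_iff₀ hpp, mul_comm]; exact h
        refine (mul_le_mul_of_nonneg_left h' (Nat.cast_nonneg _)).trans (le_of_eq ?_)
        rw [hprod, hcard, pow_succ]
        have := (hCpos v).ne'
        generalize ∏ u ∈ (Y w).erase v, ((C u).card : ℝ) = Q at hpp
        field_simp
      have hcast : ((C v).card : ℝ) * N ≤ (satisfying C z s Y bad (insert v X)).card +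
          ∑ w ∈ s.filter (fun w => v ∈ Y w ∧ Y w ⊆ insert v X),
            ((violating C z Y bad w).card : ℝ) *
              (satisfying C z s Y bad (insert v X \ Y w)).card := by
        rw [hN]; exact_mod_cast hmain
      have hN0 : 0 ≤ (C v).card * N / 2 := by positivity
      have hle : ∑ w ∈ s.filter (fun w => v ∈ Y w ∧ Y w ⊆ insert v X),
            ((violating C z Y bad w).card : ℝ) *
              (satisfying C z s Y bad (insert v X \ Y w)).card ≤ (C v).card * N / 2 := by
        refine (Finset.sum_le_sum hterm).trans ?_
        rw [← Finset.sum_mul]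
        refine (mul_le_mul_of_nonneg_right (le_trans ?_ (hsum v)) hN0).trans (one_mul _).le
        refine Finset.sum_le_sum_of_subset_of_nonneg ?_ fun w _ _ =>
          mul_nonneg (div_nonneg (Nat.cast_nonneg _)
            (Finset.prod_nonneg fun u _ => (hCpos u).le)) (by positivity)
        intro w hw
        rw [Finset.mem_filter] at hw ⊢
        exact ⟨hw.1, hw.2.1⟩
      linarith
  have hfin := prod_mul_card_satisfying_le (n := (Finset.univ : Finset α).card)
    (hgrow _) Finset.univ Finset.univ le_rfl subset_rfl
  have hne : (satisfying C z s Y bad ∅).Nonempty := by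
    refine ⟨fun _ => z, ?_⟩
    simp only [satisfying, Finset.mem_filter, mem_assignments]
    refine ⟨by simp, fun w hw hs => ?_⟩
    exact absurd (Finset.subset_empty.1 hs) (hY w hw).ne_empty
  have hpos : (0 : ℝ) < (∏ v : α, ((C v).card : ℝ)) *
      (satisfying C z s Y bad (Finset.univ \ Finset.univ)).card := by
    rw [Finset.sdiff_self]
    refine mul_pos (Finset.prod_pos fun u _ => hCpos u) ?_
    exact_mod_cast hne.card_pos
  have hpos2 := lt_of_lt_of_le hpos hfin
  have hc : 0 < (satisfying C z s Y bad Finset.univ).card := by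
    by_contra h0
    have : (satisfying C z s Y bad Finset.univ).card = 0 := by omega
    rw [this] at hpos2
    simp at hpos2
  obtain ⟨f, hf⟩ := Finset.card_pos.1 hc
  simp only [satisfying, Finset.mem_filter, mem_assignments] at hf
  exact ⟨f, fun v => hf.1.1 v (Finset.mem_univ v), fun w hw => hf.2 w hw (Finset.subset_univ _)⟩

end LocalLemma

/-! ### Dependent random choice -/

section DependentRandomChoice

open scoped Classical

variable {W : Type*}

/-- The common out-neighbours in `U'` of the entries of the tuple `S`. -/
noncomputable def commonOut (adj : W → W → Prop) (U' : Finset W) {k : ℕ} (S : Fin k → W) :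
    Finset W :=
  U'.filter fun y => ∀ j, adj (S j) y

/-- The `k`-tuples in `U` with fewer than `2 ^ (-b) * |U'|` common out-neighbours in `U'`. -/
noncomputable def sparseTuples (adj : W → W → Prop) (b : ℕ) (U' U : Finset W) (k : ℕ) :
    Finset (Fin k → W) :=
  (Fintype.piFinset fun _ => U).filter fun S => (commonOut adj U' S).card * 2 ^ b < U'.card

variable {adj : W → W → Prop}

/-- Prepending an entry can only shrink the common out-neighbourhood. Thus a bound on sparse
`q`-tuples also serves vertices of in-degree below `q`. -/
lemma card_sparseTuples_mul_le (b : ℕ) (U' U : Finset W) (k : ℕ) :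
    (sparseTuples adj b U' U k).card * U.card ≤ (sparseTuples adj b U' U (k + 1)).card := by
  rw [← Finset.card_product]
  apply Finset.card_le_card_of_injOn (fun p => (Fin.cons p.2 p.1 : Fin (k + 1) → W))
  · rintro ⟨S, u⟩ h
    simp only [Finset.coe_product, Set.mem_prod, Finset.mem_coe, sparseTuples,
      Finset.mem_filter, Fintype.mem_piFinset] at h ⊢
    refine ⟨fun j => ?_, lt_of_le_of_lt ?_ h.1.2⟩
    · refine Fin.cases ?_ (fun j => ?_) j
      · simpa using h.2
      · simpa using h.1.1 j
    · refine Nat.mul_le_mul_right _ (Finset.card_le_card fun y hy => ?_)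
      simp only [commonOut, Finset.mem_filter] at hy ⊢
      exact ⟨hy.1, fun j => by simpa using hy.2 j.succ⟩
  · rintro ⟨S, u⟩ _ ⟨S', u'⟩ _ h
    have := Fin.cons_injective2 h
    exact Prod.ext this.2 this.1

lemma card_sparseTuples_mul_pow_le (b : ℕ) (U' U : Finset W) (k r : ℕ) :
    (sparseTuples adj b U' U k).card * U.card ^ r ≤ (sparseTuples adj b U' U (k + r)).card := by
  induction r with
  | zero => simp
  | succ r ih =>
    calc _ = (sparseTuples adj b U' U k).card * U.card ^ r * U.card := by ring
      _ ≤ (sparseTuples adj b U' U (k + r)).card * U.card := Nat.mul_le_mul_right _ ih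
      _ ≤ _ := card_sparseTuples_mul_le b U' U (k + r)

/-- The power mean inequality: a lower bound for an average passes to powers. -/
lemma pow_le_sum_pow_of_le_sum {ι : Type*} (s : Finset ι) (f : ι → ℝ) (hf : ∀ i ∈ s, 0 ≤ f i)
    (x : ℝ) (hx : 0 ≤ x) (h : s.card * x ≤ ∑ i ∈ s, f i) (n : ℕ) :
    s.card * x ^ n ≤ ∑ i ∈ s, f i ^ n := by
  rcases n with _ | n
  · simp
  rcases s.eq_empty_or_nonempty with rfl | hs
  · simp
  have hc : (0 : ℝ) < s.card := by exact_mod_cast hs.card_pos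
  have h1 := pow_sum_le_card_mul_sum_pow hf n
  have h2 : (s.card * x) ^ (n + 1) ≤ (∑ i ∈ s, f i) ^ (n + 1) :=
    pow_le_pow_left₀ (by positivity) h _
  have h3 := h2.trans h1
  rw [mul_pow, pow_succ (s.card : ℝ), mul_assoc] at h3
  exact le_of_mul_le_mul_left h3 (by positivity)

/-- Dependent random choice: among the common in-neighbourhoods in `I` of `t` elements of `U'`,
one is large and contains few sparse `q`-tuples. -/
theorem exists_subset_few_sparseTuples (I U' : Finset W) (hU' : U'.Nonempty) (κ : ℝ)
    (hκ : 0 ≤ κ) (q t b : ℕ)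
    (hdens : κ * I.card * U'.card ≤ ∑ u ∈ I, ((U'.filter (adj u)).card : ℝ)) :
    ∃ U ⊆ I, (κ ^ t * I.card) ^ q ≤ 2 * (U.card : ℝ) ^ q ∧
      ((sparseTuples adj b U' U q).card : ℝ) * ((κ ^ q) ^ t * 2 ^ (b * t)) ≤
        2 * (U.card : ℝ) ^ q := by
  set Ω : Finset (Fin t → W) := Fintype.piFinset fun _ => U' with hΩ
  have hΩc : Ω.card = U'.card ^ t := by simp [hΩ]
  have hΩne : Ω.Nonempty := by
    rw [← Finset.card_pos, hΩc]; exact pow_pos hU'.card_pos _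
  set N : (Fin t → W) → Finset W := fun T => I.filter fun u => ∀ j, adj u (T j) with hN
  have hcount : ∀ A : Finset W, (A ⊆ U') →
      (Ω.filter fun T => ∀ j, T j ∈ A).card = A.card ^ t := by
    intro A hA
    have : (Ω.filter fun T => ∀ j, T j ∈ A) = Fintype.piFinset fun _ => A := by
      ext T
      simp only [hΩ, Finset.mem_filter, Fintype.mem_piFinset]
      exact ⟨fun h => h.2, fun h => ⟨fun j => hA (h j), h⟩⟩
    rw [this]; simp
  have hN1 : ∑ T ∈ Ω, ((N T).card : ℝ) = ∑ u ∈ I, ((U'.filter (adj u)).card : ℝ) ^ t := by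
    have h : ∑ T ∈ Ω, (N T).card = ∑ u ∈ I, (U'.filter (adj u)).card ^ t := by
      have := Finset.sum_card_bipartiteAbove_eq_sum_card_bipartiteBelow
        (s := Ω) (t := I) (fun T u => ∀ j, adj u (T j))
      simp only [Finset.bipartiteAbove, Finset.bipartiteBelow] at this
      rw [hN, this]
      refine Finset.sum_congr rfl fun u _ => ?_
      rw [← hcount _ (Finset.filter_subset _ _)]
      congr 1
      ext T
      simp only [hΩ, Finset.mem_filter, Fintype.mem_piFinset]
      exact ⟨fun h => ⟨h.1, fun j => ⟨h.1 j, h.2 j⟩⟩, fun h => ⟨h.1, fun j => (h.2 j).2⟩⟩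
    exact_mod_cast h
  have hN2 : (Ω.card : ℝ) * (κ ^ t * I.card) ≤ ∑ T ∈ Ω, ((N T).card : ℝ) := by
    rw [hN1, hΩc]
    have := pow_le_sum_pow_of_le_sum I (fun u => ((U'.filter (adj u)).card : ℝ))
      (fun _ _ => Nat.cast_nonneg _) (κ * U'.card) (by positivity) (by linarith) t
    refine le_trans (le_of_eq ?_) this
    push_cast; ring
  have hN3 := pow_le_sum_pow_of_le_sum Ω (fun T => ((N T).card : ℝ))
    (fun _ _ => Nat.cast_nonneg _) (κ ^ t * I.card) (by positivity) hN2 q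
  have hS : (∑ T ∈ Ω, ((sparseTuples adj b U' (N T) q).card : ℝ)) * 2 ^ (b * t) ≤
      (I.card : ℝ) ^ q * Ω.card := by
    have h : ∑ T ∈ Ω, (sparseTuples adj b U' (N T) q).card =
        ∑ S ∈ sparseTuples adj b U' I q, (commonOut adj U' S).card ^ t := by
      have := Finset.sum_card_bipartiteAbove_eq_sum_card_bipartiteBelow
        (s := Ω) (t := sparseTuples adj b U' I q) (fun T S => ∀ i, ∀ j, adj (S i) (T j))
      simp only [Finset.bipartiteAbove, Finset.bipartiteBelow] at this
      refine Eq.trans ?_ (this.trans ?_)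
      · refine Finset.sum_congr rfl fun T _ => congrArg _ ?_
        ext S
        simp only [hN, sparseTuples, Finset.mem_filter, Fintype.mem_piFinset]
        exact ⟨fun h => ⟨⟨fun i => (h.1 i).1, h.2⟩, fun i => (h.1 i).2⟩,
          fun h => ⟨fun i => ⟨h.1.1 i, h.2 i⟩, h.1.2⟩⟩
      · refine Finset.sum_congr rfl fun S _ => ?_
        rw [commonOut, ← hcount _ (Finset.filter_subset _ _)]
        congr 1
        ext T
        simp only [hΩ, Finset.mem_filter, Fintype.mem_piFinset]
        exact ⟨fun h => ⟨h.1, fun j => ⟨h.1 j, fun i => h.2 i j⟩⟩,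
          fun h => ⟨h.1, fun i j => (h.2 j).2 i⟩⟩
    have h2 : (∑ T ∈ Ω, (sparseTuples adj b U' (N T) q).card) * 2 ^ (b * t) ≤
        I.card ^ q * Ω.card := by
      rw [h, Finset.sum_mul, hΩc]
      calc _ ≤ ∑ S ∈ sparseTuples adj b U' I q, U'.card ^ t := by
            refine Finset.sum_le_sum fun S hS => ?_
            rw [pow_mul, ← mul_pow]
            exact Nat.pow_le_pow_left (Finset.mem_filter.1 hS).2.le _
        _ = (sparseTuples adj b U' I q).card * U'.card ^ t := by simp
        _ ≤ I.card ^ q * U'.card ^ t := by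
            refine Nat.mul_le_mul_right _ ((Finset.card_filter_le _ _).trans ?_)
            simp
    exact_mod_cast h2
  -- On average over `T`, each summand on the left is at most (κ ^ t |I|) ^ q, while the average of
  -- |N T| ^ q is at least that. Comparing the sum with 2 |N T| ^ q makes a single `T` serve both
  -- conclusions.
  have hex : ∃ T ∈ Ω, (κ ^ t * I.card) ^ q +
      ((sparseTuples adj b U' (N T) q).card : ℝ) * ((κ ^ q) ^ t * 2 ^ (b * t)) ≤
        2 * ((N T).card : ℝ) ^ q := by
    apply Finset.exists_le_of_sum_le hΩne
    rw [Finset.sum_add_distrib, ← Finset.sum_mul, ← Finset.mul_sum, Finset.sum_const,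
      nsmul_eq_mul]
    have h4 : (∑ T ∈ Ω, ((sparseTuples adj b U' (N T) q).card : ℝ)) *
        ((κ ^ q) ^ t * 2 ^ (b * t)) ≤ (κ ^ q) ^ t * ((I.card : ℝ) ^ q * Ω.card) := by
      refine le_trans (le_of_eq ?_) (mul_le_mul_of_nonneg_left hS (by positivity))
      ring
    have h5 : (κ ^ q) ^ t * ((I.card : ℝ) ^ q * Ω.card) = Ω.card * (κ ^ t * I.card) ^ q := by
      rw [mul_pow, ← pow_mul, ← pow_mul, mul_comm q t]; ring
    linarith
  obtain ⟨T, -, hT⟩ := hex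
  refine ⟨N T, Finset.filter_subset _ _, ?_, ?_⟩
  · have : (0 : ℝ) ≤ ((sparseTuples adj b U' (N T) q).card : ℝ) *
      ((κ ^ q) ^ t * 2 ^ (b * t)) := by positivity
    linarith
  · have : (0 : ℝ) ≤ (κ ^ t * I.card) ^ q := by positivity
    linarith

end DependentRandomChoice

/-! ### Median orders and chains of dense blocks -/

section MedianOrder

open scoped Classical

variable {W : Type*}

/-- The number of pairs of entries of a list that span an edge directed forward. -/
noncomputable def forwardPairs (adj : W → W → Prop) : List W → ℕ
  | [] => 0
  | a :: l => l.countP (fun b => adj a b) + forwardPairs adj l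

/-- The number of edges from the entries of one list to those of another. -/
noncomputable def crossPairs (adj : W → W → Prop) (l₁ l₂ : List W) : ℕ :=
  (l₁.map fun a => l₂.countP fun b => adj a b).sum

/-- A list is a median order if moving one entry to the left cannot increase the number of forward
edges: at least half of every interval ending right before `v` consists of in-neighbours of `v`. -/
def IsMedianOrder (adj : W → W → Prop) (l : List W) : Prop :=
  ∀ p m v s, l = p ++ m ++ v :: s → m.length ≤ 2 * m.countP fun x => adj x v

variable {adj : W → W → Prop}

lemma crossPairs_perm {l₁ l₁' l₂ l₂' : List W} (h₁ : l₁.Perm l₁') (h₂ : l₂.Perm l₂') :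
    crossPairs adj l₁ l₂ = crossPairs adj l₁' l₂' := by
  have : (fun a => l₂.countP fun b => decide (adj a b)) =
      fun a => l₂'.countP fun b => decide (adj a b) := by
    funext a; exact h₂.countP_eq _
  unfold crossPairs
  rw [this]
  exact (h₁.map _).sum_eq

lemma crossPairs_singleton (l : List W) (v : W) :
    crossPairs adj l [v] = l.countP fun x => adj x v := by
  induction l with
  | nil => rfl
  | cons a l ih =>
    simp only [crossPairs, List.map_cons, List.sum_cons] at ih ⊢
    rw [ih]
    simp only [List.countP_cons, List.countP_nil]
    omega

lemma forwardPairs_append (l₁ l₂ : List W) : forwardPairs adj (l₁ ++ l₂) =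
    forwardPairs adj l₁ + forwardPairs adj l₂ + crossPairs adj l₁ l₂ := by
  induction l₁ with
  | nil => simp [forwardPairs, crossPairs]
  | cons a l ih =>
    simp only [List.cons_append, forwardPairs, List.countP_append, ih, crossPairs, List.map_cons,
      List.sum_cons]
    omega

/-- Take a permutation with the most forward pairs. Moving `v` in front of `m` changes only the
pairs between `v` and `m`, so `m` has at least as many in-neighbours of `v` as out-neighbours. -/
lemma exists_isMedianOrder [Fintype W] (hadj : ∀ u v, u ≠ v → ¬ adj u v → adj v u) :
    ∃ l : List W, l.Nodup ∧ l.length = Fintype.card W ∧ IsMedianOrder adj l := by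
  set l₀ := (Finset.univ : Finset W).toList with hl₀
  obtain ⟨l, hl, hmax⟩ := Finset.exists_max_image l₀.permutations.toFinset (forwardPairs adj)
    ⟨l₀, by simp⟩
  rw [List.mem_toFinset, List.mem_permutations] at hl
  have hnd : l.Nodup := hl.nodup_iff.2 (Finset.nodup_toList _)
  refine ⟨l, hnd, by rw [hl.length_eq, hl₀, Finset.length_toList, Finset.card_univ], ?_⟩
  intro p m v s hls
  have hperm : (m ++ [v]).Perm (v :: m) := List.perm_append_comm
  have hls' : l = p ++ ((m ++ [v]) ++ s) := by rw [hls]; simp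
  have hperm' : (p ++ ((v :: m) ++ s)).Perm l := by
    rw [hls']
    exact (hperm.symm.append_right s).append_left p
  have h := hmax (p ++ ((v :: m) ++ s)) (by
    rw [List.mem_toFinset, List.mem_permutations]
    exact hperm'.trans hl)
  have e1 := crossPairs_perm (adj := adj) (List.Perm.refl p) (hperm.append_right s)
  have e2 := crossPairs_perm (adj := adj) hperm (List.Perm.refl s)
  rw [hls'] at h
  simp only [forwardPairs_append p, forwardPairs_append (m ++ [v]),
    forwardPairs_append (v :: m)] at h
  rw [forwardPairs_append m [v], crossPairs_singleton] at h
  simp only [forwardPairs, List.countP_nil] at h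
  have hle : (m.countP fun b => adj v b) ≤ m.countP fun x => adj x v := by omega
  have hvm : v ∉ m := by
    rw [hls, List.append_assoc] at hnd
    have := (List.nodup_append.1 hnd).2.1
    intro hv
    exact (List.nodup_append.1 this).2.2 v hv v (List.mem_cons_self) rfl
  have hsum := List.length_eq_countP_add_countP (fun x => decide (adj x v)) (l := m)
  have hle2 : (m.countP fun x => ¬ (decide (adj x v)) = true) ≤ m.countP fun b => adj v b := by
    refine List.countP_mono_left fun x hx hxv => ?_
    simp only [decide_eq_true_eq] at hxv ⊢
    exact hadj x v (fun h => hvm (h ▸ hx)) hxv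
  omega

/-- Averaging: if the first `n` entries fall short of the average `c`, the remaining ones still
reach it. -/
lemma exists_dense_block (f : W → ℝ) (c : ℝ) (n : ℕ) : ∀ (r : ℕ) (J : List W),
    J.length = (r + 1) * n → c * J.length ≤ (J.map f).sum →
      ∃ a I b, J = a ++ I ++ b ∧ I.length = n ∧ c * n ≤ (I.map f).sum := by
  intro r
  induction r with
  | zero =>
    intro J hJ hs
    have hJ' : J.length = n := by omega
    exact ⟨[], J, [], by simp, hJ', by rwa [hJ'] at hs⟩
  | succ r ih =>
    intro J hJ hs
    have hlen : (J.take n).length = n := by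
      rw [List.length_take, hJ]
      exact min_eq_left (Nat.le_mul_of_pos_left _ (by omega))
    by_cases h : c * n ≤ ((J.take n).map f).sum
    · exact ⟨[], J.take n, J.drop n, by simp, hlen, h⟩
    · have hd : (J.drop n).length = (r + 1) * n := by
        rw [List.length_drop, hJ, add_mul (r + 1), one_mul, Nat.add_sub_cancel]
      have hsplit : (J.map f).sum = ((J.take n).map f).sum + ((J.drop n).map f).sum := by
        rw [← List.sum_append, ← List.map_append, List.take_append_drop]
      obtain ⟨a, I, b, hab, hI, hsI⟩ := ih (J.drop n) hd (by
        rw [hd]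
        rw [hsplit, hJ] at hs
        push_cast at hs ⊢
        push Not at h
        linarith)
      exact ⟨J.take n ++ a, I, b, by
        conv_lhs => rw [← List.take_append_drop n J, hab]
        simp, hI, hsI⟩

lemma sum_card_filter_eq_sum_countP (J : List W) (U : Finset W) :
    (J.map fun x => ((U.filter (adj x)).card : ℝ)).sum =
      ∑ v ∈ U, ((J.countP fun x => adj x v : ℕ) : ℝ) := by
  induction J with
  | nil => simp
  | cons a J ih =>
    rw [List.map_cons, List.sum_cons, ih, Finset.card_filter]
    push_cast
    rw [← Finset.sum_add_distrib]
    refine Finset.sum_congr rfl fun v _ => ?_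
    rw [List.countP_cons]
    push_cast
    simp only [decide_eq_true_eq]
    ring

/-- In a median order, the block of length `n` can be chosen close before `I'` such that the density
of edges from it to a subset `U'` of `I'` is almost `1 / 2`. -/
lemma IsMedianOrder.exists_block {l p I' s : List W} (hmed : IsMedianOrder adj l)
    (hl : l = p ++ I' ++ s) (U' : Finset W) (hU' : U' ⊆ I'.toFinset) (K n n' : ℕ) (hK : 1 ≤ K)
    (hI' : I'.length ≤ n') (hp : K * (n + n') ≤ p.length) :
    ∃ q I b, p = q ++ I ++ b ∧ I.length = n ∧ p.length ≤ q.length + K * (n + n') ∧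
      ((K - 1 : ℝ) / (2 * K)) * n * U'.card ≤
        (I.map fun x => ((U'.filter (adj x)).card : ℝ)).sum := by
  -- For `n > 0` the inner factor is the first multiple of `n` above `n'`, hence at most `n + n'`.
  -- So the stretch `J` just before `I'` splits into blocks of length `n`, and is so long that the
  -- at most `n'` entries of `I'` before `v` matter only by a fraction 1/K.
  set M := K * ((n' / n + 1) * n) with hM
  have hMle : M ≤ K * (n + n') := by
    refine Nat.mul_le_mul_left _ ?_
    have := Nat.div_mul_le_self n' n
    rw [add_mul]; omega
  have hMge : n = 0 ∨ K * n' ≤ M := by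
    rcases Nat.eq_zero_or_pos n with h | h
    · exact Or.inl h
    · refine Or.inr (Nat.mul_le_mul_left _ ?_)
      have h1 := Nat.div_add_mod n' n
      have h2 := Nat.mod_lt n' h
      rw [add_mul, mul_comm (n' / n)]; omega
  set p' := p.take (p.length - M) with hp'
  set J := p.drop (p.length - M) with hJ
  have hpJ : p = p' ++ J := (List.take_append_drop _ _).symm
  have hJlen : J.length = M := by rw [hJ, List.length_drop]; omega
  have hp'len : p'.length = p.length - M := by
    rw [hp', List.length_take]; omega
  have hKpos : (0 : ℝ) < K := by exact_mod_cast hK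
  have hv : ∀ v ∈ U', ((K - 1 : ℝ) / (2 * K)) * J.length ≤
      ((J.countP fun x => adj x v : ℕ) : ℝ) := by
    intro v hv
    obtain ⟨a, c, hac⟩ := List.append_of_mem (List.mem_toFinset.1 (hU' hv))
    have h := hmed p' (J ++ a) v (c ++ s) (by rw [hl, hpJ, hac]; simp)
    rw [List.length_append, List.countP_append] at h
    have h2 : (a.countP fun x => adj x v) ≤ a.length := List.countP_le_length
    have ha : a.length ≤ n' := by rw [hac, List.length_append] at hI'; omega
    rcases hMge with h0 | hge
    · have : J.length = 0 := by rw [hJlen, hM, h0]; simp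
      rw [this]; simp
    · have h3 : J.length ≤ 2 * (J.countP fun x => adj x v) + n' := by omega
      have h3' : (J.length : ℝ) ≤ 2 * ((J.countP fun x => adj x v : ℕ) : ℝ) + n' := by
        exact_mod_cast h3
      have hge' : (K : ℝ) * n' ≤ J.length := by rw [hJlen]; exact_mod_cast hge
      rw [div_mul_eq_mul_div, div_le_iff₀ (by positivity)]
      have := mul_le_mul_of_nonneg_left h3' hKpos.le
      linarith
  obtain ⟨a, I, b, hab, hI, hsum⟩ := exists_dense_block
    (fun x => ((U'.filter (adj x)).card : ℝ)) (((K - 1 : ℝ) / (2 * K)) * U'.card) (K * n)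
    (n' / n) J (by rw [hJlen, hM]; ring) (by
      rw [sum_card_filter_eq_sum_countP]
      refine le_trans (le_of_eq ?_) (Finset.card_nsmul_le_sum U' _ _ hv)
      rw [nsmul_eq_mul]; ring)
  obtain ⟨K', rfl⟩ : ∃ K', K = K' + 1 := ⟨K - 1, by omega⟩
  obtain ⟨a', I', b', hab', hI', hsum'⟩ := exists_dense_block
    (fun x => ((U'.filter (adj x)).card : ℝ))
    ((((K' + 1 : ℕ) - 1 : ℝ) / (2 * (K' + 1 : ℕ))) * U'.card) n K' I hI (by rw [hI]; exact hsum)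
  refine ⟨p' ++ a ++ a', I', b' ++ b, ?_, hI', ?_, ?_⟩
  · rw [hpJ, hab, hab']; simp
  · simp only [List.length_append]; omega
  · refine le_trans (le_of_eq ?_) hsum'
    ring

/-- Along a median order one can choose, from right to left, subsets of successive blocks. -/
theorem IsMedianOrder.exists_chain {l : List W} (hmed : IsMedianOrder adj l) (hnd : l.Nodup)
    (K H : ℕ) (hK : 1 ≤ K) (n u : ℕ → ℕ) (hu : u (H + 1) = 0)
    (R : ℕ → Finset W → Finset W → Prop)
    (hstep : ∀ i, 1 ≤ i → i ≤ H → ∀ I U' : Finset W, I.card = n i → u (i + 1) ≤ U'.card →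
      ((K - 1 : ℝ) / (2 * K)) * I.card * U'.card ≤ ∑ x ∈ I, ((U'.filter (adj x)).card : ℝ) →
      ∃ U ⊆ I, u i ≤ U.card ∧ R i U U')
    (hlen : ∑ i ∈ Finset.Ico 1 (H + 1), K * (n i + n (i + 1)) ≤ l.length) :
    ∃ U : ℕ → Finset W,
      (∀ i, 1 ≤ i → i ≤ H → ∀ j, 1 ≤ j → j ≤ H → i ≠ j → Disjoint (U i) (U j)) ∧
      ∀ i, 1 ≤ i → i ≤ H → u i ≤ (U i).card ∧ R i (U i) (U (i + 1)) := by
  have key : ∀ k i, 1 ≤ i → i + k = H + 1 → ∃ (U : ℕ → Finset W) (p I s : List W),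
      l = p ++ I ++ s ∧ I.length ≤ n i ∧ U i ⊆ I.toFinset ∧ u i ≤ (U i).card ∧
      ∑ j ∈ Finset.Ico 1 i, K * (n j + n (j + 1)) ≤ p.length ∧
      (∀ j, i ≤ j → j ≤ H → U j ⊆ (I ++ s).toFinset) ∧
      (∀ j, i ≤ j → j ≤ H → ∀ j', i ≤ j' → j' ≤ H → j ≠ j' → Disjoint (U j) (U j')) ∧
      ∀ j, i ≤ j → j ≤ H → u j ≤ (U j).card ∧ R j (U j) (U (j + 1)) := by
    intro k
    induction k with
    | zero =>
      intro i _ hi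
      have hi : i = H + 1 := by omega
      subst hi
      -- Past the last layer the chain starts from the empty set, which `u (H + 1) = 0` permits.
      refine ⟨fun _ => ∅, l, [], [], by simp, by simp, by simp, by simp [hu], hlen, ?_, ?_, ?_⟩
      all_goals intro j hj hj'; omega
    | succ k ih =>
      intro i hi hik
      obtain ⟨U, p, I', s, hl, hI', hUI', huI', hsum, hsub, hdisj, hR⟩ :=
        ih (i + 1) (by omega) (by omega)
      rw [Finset.sum_Ico_succ_top hi] at hsum
      obtain ⟨q, I, b, hp, hI, hq, hdens⟩ := hmed.exists_block hl (U (i + 1)) hUI' K (n i)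
        (n (i + 1)) hK hI' (by omega)
      have hndI : I.Nodup := by
        rw [hl, hp] at hnd
        exact (List.nodup_append.1 (List.nodup_append.1 (List.nodup_append.1
          (List.nodup_append.1 hnd).1).1).1).2.1
      have hcI : I.toFinset.card = n i := by rw [List.toFinset_card_of_nodup hndI, hI]
      obtain ⟨V, hVI, huV, hRV⟩ := hstep i hi (by omega) I.toFinset (U (i + 1)) hcI huI' (by
        rw [hcI, List.sum_toFinset _ hndI]; exact hdens)
      have hdisjI : Disjoint I.toFinset (I' ++ s).toFinset := by
        have hl' : l = (q ++ I) ++ (b ++ (I' ++ s)) := by rw [hl, hp]; simp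
        rw [hl'] at hnd
        have h := (List.nodup_append.1 hnd).2.2
        rw [Finset.disjoint_left]
        intro x hx hx'
        rw [List.mem_toFinset] at hx hx'
        exact h x (List.mem_append_right _ hx) x (List.mem_append_right _ hx') rfl
      have hne : ∀ j, i + 1 ≤ j → Function.update U i V j = U j := fun j hj =>
        Function.update_of_ne (by omega) _ _
      have hself : Function.update U i V i = V := Function.update_self _ _ _
      refine ⟨Function.update U i V, q, I, b ++ I' ++ s, ?_, hI.le, ?_, ?_, ?_, ?_, ?_, ?_⟩
      · rw [hl, hp]; simp
      · rw [hself]; exact hVI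
      · rw [hself]; exact huV
      · omega
      · intro j hj hj'
        rcases Nat.eq_or_lt_of_le hj with rfl | hlt
        · rw [hself]
          intro x hx
          have := List.mem_toFinset.1 (hVI hx)
          simp [this]
        · rw [hne j hlt]
          intro x hx
          have := List.mem_toFinset.1 (hsub j hlt hj' hx)
          simp only [List.mem_toFinset, List.mem_append] at this ⊢
          tauto
      · intro j hj hjH j' hj' hjH' hjj
        rcases Nat.eq_or_lt_of_le hj with rfl | hlt
        · rw [hself, hne j' (by omega)]
          exact Finset.disjoint_of_subset_left hVI
            (Finset.disjoint_of_subset_right (hsub j' (by omega) hjH') hdisjI)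
        · rw [hne j hlt]
          rcases Nat.eq_or_lt_of_le hj' with rfl | hlt'
          · rw [hself]
            exact (Finset.disjoint_of_subset_left hVI
              (Finset.disjoint_of_subset_right (hsub j (by omega) hjH) hdisjI)).symm
          · rw [hne j' hlt']
            exact hdisj j hlt hjH j' hlt' hjH' hjj
      · intro j hj hjH
        rw [hne (j + 1) (by omega)]
        rcases Nat.eq_or_lt_of_le hj with rfl | hlt
        · rw [hself]; exact ⟨huV, hRV⟩
        · rw [hne j hlt]; exact hR j hlt hjH
  obtain ⟨U, p, I, s, -, -, -, -, -, -, h1, h2⟩ := key H 1 le_rfl (by omega)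
  exact ⟨U, h1, h2⟩

end MedianOrder

/-! ### Choice of parameters for one step of the chain -/

section Parameters

open scoped Classical

variable {W : Type*} {adj : W → W → Prop}

/-- For consecutive layer in-degrees `p`, `q`, a tuple is sparse if it has at most a proportion
`2 ^ (-sparsity p q)` of common out-neighbours. -/
def sparsity (p q : ℕ) : ℕ := q + min q p + 4

/-- Bernoulli's inequality: the base is 1/2 (1 - 1/(14 d)), and at most 7 d factors lose only a
factor 2 altogether. The number 14 is tuned to the largest exponent needed, 2 p + 5 ≤ 7 d. -/
lemma half_pow_le_pow {d t : ℕ} (hd : 1 ≤ d) (ht : t ≤ 7 * d) :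
    (1 / 2 : ℝ) ^ (t + 1) ≤ (((14 * d : ℕ) - 1 : ℝ) / (2 * (14 * d : ℕ))) ^ t := by
  have hd' : (1 : ℝ) ≤ d := by exact_mod_cast hd
  have ht' : (t : ℝ) ≤ 7 * d := by exact_mod_cast ht
  have heq : (((14 * d : ℕ) - 1 : ℝ) / (2 * (14 * d : ℕ))) =
      (1 / 2) * (1 + -(1 / (14 * d))) := by
    push_cast
    field_simp
    ring
  have hb : 1 + (t : ℝ) * -(1 / (14 * d)) ≤ (1 + -(1 / (14 * d))) ^ t := by
    refine one_add_mul_le_pow ?_ t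
    have : (1 : ℝ) / (14 * d) ≤ 1 := by
      rw [div_le_one (by positivity)]; linarith
    linarith
  have hb2 : (1 / 2 : ℝ) ≤ 1 + (t : ℝ) * -(1 / (14 * d)) := by
    have : (t : ℝ) * (1 / (14 * d)) ≤ 1 / 2 := by
      rw [mul_one_div, div_le_iff₀ (by positivity)]; linarith
    linarith
  rw [heq, mul_pow, pow_succ]
  gcongr
  exact hb2.trans hb

lemma quarter_le {d : ℕ} (hd : 1 ≤ d) :
    (1 / 2 : ℝ) ^ 2 ≤ ((14 * d : ℕ) - 1 : ℝ) / (2 * (14 * d : ℕ)) := by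
  have := half_pow_le_pow (t := 1) hd (by omega)
  simpa using this

/-- The choice of the number `t` of vertices in the dependent random choice; the loss in size is a
factor of at most `2 ^ g`. -/
lemma exists_choice_parameters {o p q d D δ np n₀ n n' : ℕ} (hd : 1 ≤ d) (hp : p ≤ d)
    (hq : q ≤ d) (hδ : 2 ^ δ ≤ 16 * D) (hnp : np ≤ D * n') (hn : np + n₀ = n) (hD : 1 ≤ D) :
    ∃ t g, (sparsity o p + 1) * q + δ ≤ (min q p + 3) * t ∧
      (1 / 2 : ℝ) ^ g ≤ (((14 * d : ℕ) - 1 : ℝ) / (2 * (14 * d : ℕ))) ^ t ∧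
      2 ^ (g + 1) * (16 * (2 ^ sparsity o p * np + n₀)) ≤
        2 ^ 20 * D * (2 ^ (2 * (p + q)) * n + 2 ^ (2 * (o + p)) * n') := by
  set κ : ℝ := ((14 * d : ℕ) - 1 : ℝ) / (2 * (14 * d : ℕ)) with hκ
  set b := sparsity o p with hb
  have hb1 : b ≤ 2 * p + 4 := by simp only [hb, sparsity]; omega
  have hb2 : b ≤ p + o + 4 := by simp only [hb, sparsity]; omega
  -- `σ` is δ/3 rounded up: each choice gains at least 2 ^ 3, so `σ` choices pay for 2 ^ δ.
  obtain ⟨σ, hσ1, hσ2⟩ : ∃ σ, δ ≤ 3 * σ ∧ 3 * σ ≤ δ + 2 := ⟨(δ + 2) / 3, by omega, by omega⟩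
  have h3σ : 2 ^ (3 * σ) ≤ 64 * D := by
    calc 2 ^ (3 * σ) ≤ 2 ^ (δ + 2) := Nat.pow_le_pow_right (by norm_num) hσ2
      _ = 4 * 2 ^ δ := by ring
      _ ≤ _ := by omega
  have hsum : 2 ^ b * np + n₀ ≤ 2 ^ b * n := by
    have : 1 ≤ 2 ^ b := Nat.one_le_two_pow
    nlinarith
  have hquart : ∀ m, (1 / 2 : ℝ) ^ (2 * m) ≤ κ ^ m := fun m => by
    rw [pow_mul]
    exact pow_le_pow_left₀ (by positivity) (quarter_le hd) m
  rcases le_or_gt q p with hqp | hqp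
  · rw [min_eq_left hqp]
    rcases le_or_gt σ (b + 1) with hs | hs
    · refine ⟨b + 1, b + 2, by nlinarith, half_pow_le_pow hd (by omega), ?_⟩
      have e1 : 2 ^ (b + 2 + 1) * (16 * (2 ^ b * np + n₀)) =
          2 ^ (2 * b + 7) * np + 2 ^ (b + 7) * n₀ := by ring
      have e2 : 2 ^ (2 * b + 7) * np ≤ 2 ^ (2 * (o + p) + 20) * (D * n') :=
        Nat.mul_le_mul (Nat.pow_le_pow_right (by norm_num) (by omega)) hnp
      have e3 : 2 ^ (b + 7) * n₀ ≤ 2 ^ (2 * (p + q) + 20) * (D * n) :=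
        Nat.mul_le_mul (Nat.pow_le_pow_right (by norm_num) (by omega)) (by nlinarith)
      calc _ ≤ 2 ^ (2 * (o + p) + 20) * (D * n') + 2 ^ (2 * (p + q) + 20) * (D * n) := by
            rw [e1]; exact Nat.add_le_add e2 e3
        _ = _ := by ring
    · refine ⟨σ, 2 * σ, by nlinarith, hquart σ, ?_⟩
      calc _ ≤ 2 ^ (2 * σ + 1) * (16 * (2 ^ b * n)) := by gcongr
        _ = 2 ^ (2 * σ + b) * 2 ^ 5 * n := by ring
        _ ≤ 2 ^ (3 * σ) * 2 ^ 5 * n := by gcongr <;> omega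
        _ ≤ 64 * D * 2 ^ 5 * n := by gcongr
        _ = 2 ^ 11 * D * (1 * n + 0) := by ring
        _ ≤ _ := by
          gcongr
          · norm_num
          · norm_num
          · exact Nat.one_le_two_pow
          · exact Nat.zero_le _
  · rw [min_eq_right hqp.le]
    -- Since b + 1 ≤ 2 p + 5, the first 2 q choices pay for (b + 1) q. The crude bound κ ≥ 1/4 is
    -- applied only to the other `σ`.
    refine ⟨2 * q + σ, 2 * q + 1 + 2 * σ, by nlinarith, ?_, ?_⟩
    · rw [pow_add, pow_add κ]
      exact mul_le_mul (half_pow_le_pow hd (by omega)) (hquart σ) (by positivity)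
        (le_trans (by positivity) (half_pow_le_pow hd (by omega)))
    · have hexp : 2 ^ (2 * q + b) ≤ 2 ^ (2 * (p + q) + 4) :=
        Nat.pow_le_pow_right (by norm_num) (by omega)
      calc _ ≤ 2 ^ (2 * q + 1 + 2 * σ + 1) * (16 * (2 ^ b * n)) := by gcongr
        _ = 2 ^ (2 * σ) * 2 ^ (2 * q + b) * 2 ^ 6 * n := by ring
        _ ≤ 2 ^ (3 * σ) * 2 ^ (2 * (p + q) + 4) * 2 ^ 6 * n := by gcongr <;> norm_num
        _ ≤ (64 * D) * 2 ^ (2 * (p + q) + 4) * 2 ^ 6 * n := by gcongr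
        _ = 2 ^ 16 * D * (2 ^ (2 * (p + q)) * n + 0) := by ring
        _ ≤ _ := by
          gcongr
          · norm_num
          · norm_num
          · exact Nat.zero_le _

/-- One step of the chain: `I` contains a large set with few sparse `q`-tuples. -/
lemma exists_subset_of_dense {o p q d D δ np n₀ n n' : ℕ} (hd : 1 ≤ d) (hp : p ≤ d)
    (hq : q ≤ d) (hδ : 2 ^ δ ≤ 16 * D) (hnp : np ≤ D * n') (hn : np + n₀ = n) (hD : 1 ≤ D)
    (I U' : Finset W)
    (hI : I.card = 2 ^ 20 * D * (2 ^ (2 * (p + q)) * n + 2 ^ (2 * (o + p)) * n'))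
    (hU' : 1 ≤ q → U'.Nonempty)
    (hdens : (((14 * d : ℕ) - 1 : ℝ) / (2 * (14 * d : ℕ))) * I.card * U'.card ≤
      ∑ x ∈ I, ((U'.filter (adj x)).card : ℝ)) :
    ∃ U ⊆ I, 16 * (2 ^ sparsity o p * np + n₀) ≤ U.card ∧
      2 ^ δ * 2 ^ ((sparsity o p + 1) * q) * (sparseTuples adj (sparsity p q) U' U q).card ≤
        2 * U.card ^ q := by
  obtain ⟨t, g, ht, hg, hsize⟩ := exists_choice_parameters (o := o) hd hp hq hδ hnp hn hD
  rw [← hI] at hsize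
  set κ : ℝ := ((14 * d : ℕ) - 1 : ℝ) / (2 * (14 * d : ℕ)) with hκ
  -- The empty tuple has all of `U'` as common out-neighbourhood, so it is never sparse, even for
  -- the empty `U'` after the last layer.
  rcases Nat.eq_zero_or_pos q with rfl | hq0
  · refine ⟨I, subset_rfl, ?_, ?_⟩
    · refine le_trans ?_ hsize
      exact Nat.le_mul_of_pos_left _ (by positivity)
    · have : sparseTuples adj (sparsity p 0) U' I 0 = ∅ := by
        refine Finset.filter_eq_empty_iff.2 fun S _ => ?_
        have : commonOut adj U' S = U' := by
          refine Finset.filter_true_of_mem fun y _ j => j.elim0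
        rw [this, not_lt]
        exact Nat.le_mul_of_pos_right _ (by positivity)
      rw [this]; simp
  have hκ0 : 0 ≤ κ := le_trans (by positivity) (quarter_le hd)
  obtain ⟨U, hUI, h1, h2⟩ := exists_subset_few_sparseTuples I U' (hU' hq0) κ hκ0 q t
    (sparsity p q) hdens
  refine ⟨U, hUI, ?_, ?_⟩
  · set u := 16 * (2 ^ sparsity o p * np + n₀) with hu
    -- Otherwise (2 u) ^ q ≤ 2 |U| ^ q < 2 u ^ q, which is impossible for q ≥ 1.
    by_contra hlt
    push Not at hlt
    have hsize' : (2 : ℝ) ^ (g + 1) * u ≤ I.card := by exact_mod_cast hsize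
    have h3 : (2 : ℝ) * u ≤ κ ^ t * I.card := by
      calc (2 : ℝ) * u = (1 / 2) ^ g * (2 ^ (g + 1) * u) := by
            rw [pow_succ, one_div, inv_pow]; field_simp
        _ ≤ _ := mul_le_mul hg hsize' (by positivity) (by positivity)
    have h4 := (pow_le_pow_left₀ (by positivity) h3 q).trans h1
    have h5 : (U.card : ℝ) ^ q < (u : ℝ) ^ q :=
      pow_lt_pow_left₀ (by exact_mod_cast hlt) (by positivity) (by omega)
    rw [mul_pow] at h4
    have h6 : (2 : ℝ) ≤ 2 ^ q := by
      calc (2 : ℝ) = 2 ^ 1 := by norm_num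
        _ ≤ _ := pow_le_pow_right₀ (by norm_num) hq0
    have h7 : (0 : ℝ) ≤ (u : ℝ) ^ q := by positivity
    nlinarith
  · set s := (sparseTuples adj (sparsity p q) U' U q).card with hs
    have hκq : (1 / 2 : ℝ) ^ (q + 1) ≤ κ ^ q := half_pow_le_pow hd (by omega)
    -- Of the exponent `sparsity p q`, the part q + 1 compensates κ ^ q ≥ 2 ^ (-(q + 1)); what is
    -- left is the gain per choice.
    have h3 : (2 : ℝ) ^ ((min q p + 3) * t) ≤ (κ ^ q) ^ t * 2 ^ (sparsity p q * t) := by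
      have h4 : ((1 / 2 : ℝ) ^ (q + 1)) ^ t ≤ (κ ^ q) ^ t :=
        pow_le_pow_left₀ (by positivity) hκq t
      refine le_trans (le_of_eq ?_) (mul_le_mul_of_nonneg_right h4 (by positivity))
      have : sparsity p q * t = (min q p + 3) * t + (q + 1) * t := by
        simp only [sparsity]; ring
      rw [this, pow_add (2 : ℝ), ← pow_mul, one_div, inv_pow]
      field_simp
    have h4 : (2 : ℝ) ^ δ * 2 ^ ((sparsity o p + 1) * q) ≤ 2 ^ ((min q p + 3) * t) := by
      rw [← pow_add, add_comm δ]
      exact pow_le_pow_right₀ (by norm_num) ht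
    have h5 : (2 : ℝ) ^ δ * 2 ^ ((sparsity o p + 1) * q) * s ≤ 2 * (U.card : ℝ) ^ q := by
      refine le_trans ?_ h2
      rw [mul_comm]
      exact mul_le_mul_of_nonneg_left (h4.trans h3) (Nat.cast_nonneg _)
    exact_mod_cast h5

end Parameters

/-! ### Embedding one layer -/

section Embedding

open scoped Classical

variable {V W : Type*} [Fintype V] {adj : W → W → Prop}

/-- The possible images in `U` of a vertex `w` whose in-neighbours are embedded by `f`. -/
noncomputable def candidates (G : Digraph V) (adj : W → W → Prop) (f : V → W) (U : Finset W)
    (w : V) : Finset W :=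
  U.filter fun y => ∀ v, G.Adj v w → adj (f v) y

lemma candidates_congr {G : Digraph V} {f g : V → W} {w : V} (U : Finset W)
    (h : ∀ v, G.Adj v w → f v = g v) : candidates G adj f U w = candidates G adj g U w := by
  refine Finset.filter_congr fun y _ => forall₂_congr fun v hv => ?_
  rw [h v hv]

lemma candidates_of_no_inNeighbors {G : Digraph V} {w : V} (f : V → W) (U : Finset W)
    (h : ∀ v, ¬ G.Adj v w) : candidates G adj f U w = U :=
  Finset.filter_true_of_mem fun _ _ v hv => absurd hv (h v)

/-- In a collision the value at `a` determines the value at `b`. -/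
lemma card_collisions_le {ι : Type*} (C : V → Finset W) (z : W) (Y : ι → Finset V)
    (bad : ι → (V → W) → Prop) (i : ι) (a b : V) (hY : Y i = {a, b})
    (hbad : ∀ f, bad i f → f a = f b) :
    (violating C z Y bad i).card ≤ (C a).card := by
  refine Finset.card_le_card_of_injOn (fun f => f a) ?_ ?_
  · intro f hf
    simp only [violating, Finset.coe_filter, Set.mem_ofPred_eq, mem_assignments] at hf
    exact hf.1.1 a (by simp [hY])
  · intro f hf g hg h
    simp only [violating, Finset.coe_filter, Set.mem_ofPred_eq, mem_assignments] at hf hg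
    funext v
    by_cases hv : v ∈ Y i
    · rw [hY, Finset.mem_insert, Finset.mem_singleton] at hv
      rcases hv with rfl | rfl
      · exact h
      · rw [← hbad f hf.2, ← hbad g hg.2]; exact h
    · rw [hf.1.2 v hv, hg.1.2 v hv]

/-- Read along an enumeration of the in-neighbours of `w`, a violating assignment is a sparse tuple
that determines it. -/
lemma card_violating_le_sparseTuples {ι : Type*} (G : Digraph V) (C : V → Finset W) (z : W)
    (Y : ι → Finset V) (bad : ι → (V → W) → Prop) (i : ι) (w : V) (b : ℕ) (U U' : Finset W)
    (hY : Y i = Finset.univ.filter fun v => G.Adj v w) (hC : ∀ v ∈ Y i, C v ⊆ U)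
    (hbad : ∀ f, bad i f → (candidates G adj f U' w).card * 2 ^ b < U'.card) :
    (violating C z Y bad i).card ≤ (sparseTuples adj b U' U (Y i).card).card := by
  refine Finset.card_le_card_of_injOn (fun f j => f ((Y i).equivFin.symm j)) ?_ ?_
  · intro f hf
    simp only [violating, Finset.coe_filter, Set.mem_ofPred_eq, mem_assignments] at hf
    simp only [sparseTuples, Finset.coe_filter, Set.mem_ofPred_eq, Fintype.mem_piFinset]
    refine ⟨fun j => hC _ (Subtype.prop _) (hf.1.1 _ (Subtype.prop _)), ?_⟩
    refine lt_of_le_of_lt (Nat.mul_le_mul_right _ (Finset.card_le_card ?_)) (hbad f hf.2)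
    intro y hy
    simp only [commonOut, candidates, Finset.mem_filter] at hy ⊢
    refine ⟨hy.1, fun v hv => ?_⟩
    have hvY : v ∈ Y i := by rw [hY]; simpa using hv
    simpa using hy.2 ((Y i).equivFin ⟨v, hvY⟩)
  · intro f hf g hg h
    simp only [violating, Finset.coe_filter, Set.mem_ofPred_eq, mem_assignments] at hf hg
    funext v
    by_cases hv : v ∈ Y i
    · simpa using congrFun h ((Y i).equivFin ⟨v, hv⟩)
    · rw [hf.1.2 v hv, hg.1.2 v hv]

/-- The vertices of a layer `A` can be embedded into their candidate sets injectively such that the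
vertices of the next layer `B` have large candidate sets. -/
theorem exists_layer_embedding (G : Digraph V) (f₀ : V → W) (C : V → Finset W)
    (U U' : Finset W) (A B : Finset V) (q e b D δ : ℕ) (hD : 1 ≤ D) (hδ : 8 * D ≤ 2 ^ δ)
    (hCU : ∀ v ∈ A, C v ⊆ U) (hCcard : ∀ v ∈ A, U.card ≤ 2 ^ e * (C v).card)
    (hCne : ∀ v ∈ A, (C v).Nonempty) (hsum : ∑ v ∈ A, (1 : ℝ) / (C v).card ≤ 1 / 16)
    (hBA : ∀ w ∈ B, ∀ v, G.Adj v w → v ∈ A) (hin : ∀ w ∈ B, inDegree G w ≤ q)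
    (hout : ∀ v, outDegree G v ≤ D)
    (hsparse : 2 ^ δ * 2 ^ ((e + 1) * q) * (sparseTuples adj b U' U q).card ≤ 2 * U.card ^ q) :
    ∃ g : V → W, (∀ v ∈ A, g v ∈ C v) ∧ (∀ u ∈ A, ∀ v ∈ A, g u = g v → u = v) ∧
      ∀ w ∈ B, U'.card ≤ 2 ^ b * (candidates G adj g U' w).card := by
  rcases A.eq_empty_or_nonempty with rfl | ⟨a₀, ha₀⟩
  · refine ⟨f₀, by simp, by simp, fun w hw => ?_⟩
    rw [candidates_of_no_inNeighbors f₀ U' fun v hv => by simpa using hBA w hw v hv]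
    exact Nat.le_mul_of_pos_left _ (by positivity)
  obtain ⟨z, hz⟩ := hCne a₀ ha₀
  have hUpos : 0 < U.card := Finset.card_pos.2 ⟨z, hCU a₀ ha₀ hz⟩
  -- The local lemma wants a nonempty value set at every vertex; outside `A` a single dummy value
  -- does.
  set C' : V → Finset W := fun v => if v ∈ A then C v else {z} with hC'
  have hC'A : ∀ v ∈ A, C' v = C v := fun v hv => by simp [hC', hv]
  have hC'ne : ∀ v, (C' v).Nonempty := fun v => by
    by_cases hv : v ∈ A
    · rw [hC'A v hv]; exact hCne v hv
    · simp [hC', hv]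
  have hpos : ∀ v, (0 : ℝ) < (C' v).card := fun v => Nat.cast_pos.2 (hC'ne v).card_pos
  set inN : V → Finset V := fun w => Finset.univ.filter fun v => G.Adj v w with hinN
  have hinNcard : ∀ w, (inN w).card = inDegree G w := fun w => by
    rw [inDegree, Set.ncard_eq_toFinset_card']
    congr 1; ext v; simp [hinN]
  set s₁ := (A ×ˢ A).filter fun p => p.1 ≠ p.2 with hs₁
  -- Vertices without in-neighbours would give constraints of empty support; they have all of `U'`
  -- as candidates anyway.
  set s₂ := B.filter fun w => (inN w).Nonempty with hs₂
  set Y : (V × V) ⊕ V → Finset V := Sum.elim (fun p => {p.1, p.2}) inN with hY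
  set bad : (V × V) ⊕ V → (V → W) → Prop := Sum.elim (fun p f => f p.1 = f p.2)
    (fun w f => (candidates G adj f U' w).card * 2 ^ b < U'.card) with hbad
  have hdep : ∀ i f g, (∀ v ∈ Y i, f v = g v) → bad i f → bad i g := by
    rintro (⟨u, v⟩ | w) f g hfg h
    · simp only [hY, hbad, Sum.elim_inl] at hfg h ⊢
      rw [← hfg u (by simp), ← hfg v (by simp), h]
    · simp only [hY, hbad, Sum.elim_inr] at hfg h ⊢
      rwa [← candidates_congr U' fun v hv => hfg v (by simpa [hinN] using hv)]
  have hYne : ∀ i ∈ s₁.disjSum s₂, (Y i).Nonempty := by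
    intro i hi
    rcases i with ⟨u, v⟩ | w
    · exact ⟨u, by simp [hY]⟩
    · simp only [Finset.inr_mem_disjSum, hs₂, Finset.mem_filter] at hi
      exact hi.2
  have hden : ∀ v, ∑ i ∈ (s₁.disjSum s₂).filter (fun i => v ∈ Y i),
      ((violating C' z Y bad i).card : ℝ) / (∏ u ∈ Y i, ((C' u).card : ℝ)) *
        2 ^ (Y i).card ≤ 1 := by
    intro v
    set F : (V × V) ⊕ V → ℝ := fun i => ((violating C' z Y bad i).card : ℝ) /
      (∏ u ∈ Y i, ((C' u).card : ℝ)) * 2 ^ (Y i).card with hF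
    rw [Finset.sum_filter, Finset.sum_disjSum]
    -- A collision of `v` with `u` has density at most 1/|C u| and weight 2 ^ 2. Both orders of the
    -- pair occur, so the total is at most 2 · 4 · 1/16.
    have h1 : ∑ p ∈ s₁, (if v ∈ Y (Sum.inl p) then F (Sum.inl p) else 0) ≤ 1 / 2 := by
      have hterm : ∀ p ∈ s₁, (if v ∈ Y (Sum.inl p) then F (Sum.inl p) else 0) ≤
          (if p.1 = v then 4 * ((1 : ℝ) / (C p.2).card) else 0) +
            (if p.2 = v then 4 * ((1 : ℝ) / (C p.1).card) else 0) := by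
        rintro ⟨a, c⟩ hp
        simp only [hs₁, Finset.mem_filter, Finset.mem_product] at hp
        obtain ⟨⟨ha, hc⟩, hac⟩ := hp
        have hYp : Y (Sum.inl (a, c)) = {a, c} := rfl
        have hYp' : Y (Sum.inl (a, c)) = {c, a} := by rw [hYp, Finset.pair_comm]
        have hFe : F (Sum.inl (a, c)) = (violating C' z Y bad (Sum.inl (a, c))).card /
            (((C a).card : ℝ) * (C c).card) * 4 := by
          simp only [hF, hYp, Finset.prod_pair hac, Finset.card_pair hac, hC'A a ha, hC'A c hc]
          norm_num
        have hpa := hpos a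
        have hpc := hpos c
        rw [hC'A a ha] at hpa
        rw [hC'A c hc] at hpc
        have ka : F (Sum.inl (a, c)) ≤ 4 * ((1 : ℝ) / (C c).card) := by
          have h := card_collisions_le C' z Y bad (Sum.inl (a, c)) a c hYp fun f hf => hf
          rw [hC'A a ha] at h
          have h' : ((violating C' z Y bad (Sum.inl (a, c))).card : ℝ) ≤ (C a).card := by
            exact_mod_cast h
          rw [hFe]
          calc _ ≤ ((C a).card : ℝ) / (((C a).card : ℝ) * (C c).card) * 4 := by gcongr
            _ = _ := by field_simp
        have kc : F (Sum.inl (a, c)) ≤ 4 * ((1 : ℝ) / (C a).card) := by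
          have h := card_collisions_le C' z Y bad (Sum.inl (a, c)) c a hYp'
            fun f hf => Eq.symm hf
          rw [hC'A c hc] at h
          have h' : ((violating C' z Y bad (Sum.inl (a, c))).card : ℝ) ≤ (C c).card := by
            exact_mod_cast h
          rw [hFe]
          calc _ ≤ ((C c).card : ℝ) / (((C a).card : ℝ) * (C c).card) * 4 := by gcongr
            _ = _ := by field_simp
        have n1 : (0 : ℝ) ≤ 4 * ((1 : ℝ) / (C a).card) := by positivity
        have n2 : (0 : ℝ) ≤ 4 * ((1 : ℝ) / (C c).card) := by positivity
        rw [hYp]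
        simp only [Finset.mem_insert, Finset.mem_singleton]
        by_cases hva : a = v
        · have hcv : c ≠ v := fun h => hac (hva.trans h.symm)
          rw [if_pos (Or.inl hva.symm), if_pos hva, if_neg hcv, add_zero]
          exact ka
        · by_cases hvc : c = v
          · rw [if_pos (Or.inr hvc.symm), if_neg hva, if_pos hvc, zero_add]
            exact kc
          · rw [if_neg, if_neg hva, if_neg hvc, add_zero]
            rintro (h | h)
            · exact hva h.symm
            · exact hvc h.symm
      have hS : ∀ c : ℝ, 0 ≤ c → (if v ∈ A then c else 0) ≤ c := fun c hc => by
        split_ifs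
        · exact le_rfl
        · exact hc
      have hS0 : (0 : ℝ) ≤ ∑ u ∈ A, 4 * ((1 : ℝ) / (C u).card) :=
        Finset.sum_nonneg fun u _ => by positivity
      calc _ ≤ ∑ p ∈ s₁, ((if p.1 = v then 4 * ((1 : ℝ) / (C p.2).card) else 0) +
            (if p.2 = v then 4 * ((1 : ℝ) / (C p.1).card) else 0)) := Finset.sum_le_sum hterm
        _ ≤ ∑ p ∈ A ×ˢ A, ((if p.1 = v then 4 * ((1 : ℝ) / (C p.2).card) else 0) +
            (if p.2 = v then 4 * ((1 : ℝ) / (C p.1).card) else 0)) := by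
            refine Finset.sum_le_sum_of_subset_of_nonneg (Finset.filter_subset _ _) ?_
            intro p _ _
            refine add_nonneg ?_ ?_ <;> split_ifs <;> positivity
        _ = (if v ∈ A then ∑ u ∈ A, 4 * ((1 : ℝ) / (C u).card) else 0) +
            (if v ∈ A then ∑ u ∈ A, 4 * ((1 : ℝ) / (C u).card) else 0) := by
            rw [Finset.sum_add_distrib]
            congr 1
            · rw [Finset.sum_product_right]
              simp only [Finset.sum_ite_eq']
              split_ifs <;> simp
            · rw [Finset.sum_product]
              simp only [Finset.sum_ite_eq']
              split_ifs <;> simp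
        _ ≤ _ := by
            have := hS _ hS0
            rw [← Finset.mul_sum] at this ⊢
            linarith
    have h2 : ∑ w ∈ s₂, (if v ∈ Y (Sum.inr w) then F (Sum.inr w) else 0) ≤ 1 / 4 := by
      have hD' : (0 : ℝ) < D := by exact_mod_cast hD
      have hterm : ∀ w ∈ s₂, (if v ∈ Y (Sum.inr w) then F (Sum.inr w) else 0) ≤
          if G.Adj v w then 1 / (4 * (D : ℝ)) else 0 := by
        intro w hw
        have hmem : v ∈ Y (Sum.inr w) ↔ G.Adj v w := by simp [hY, hinN]
        simp only [hmem]
        split_ifs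
        swap
        · exact le_rfl
        have hwB : w ∈ B := (Finset.mem_filter.1 hw).1
        have hYA : ∀ u ∈ Y (Sum.inr w), u ∈ A := fun u hu =>
          hBA w hwB u (by simpa [hY, hinN] using hu)
        have hk : (Y (Sum.inr w)).card ≤ q := (hinNcard w).le.trans (hin w hwB)
        have hv1 := card_violating_le_sparseTuples (adj := adj) G C' z Y bad (Sum.inr w) w b U U'
          rfl (fun u hu => (hC'A u (hYA u hu)).symm ▸ hCU u (hYA u hu)) (fun f hf => hf)
        set k := (Y (Sum.inr w)).card with hkdef
        set N := (violating C' z Y bad (Sum.inr w)).card with hN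
        obtain ⟨r, rfl⟩ := Nat.exists_eq_add_of_le hk
        have hv2 := card_sparseTuples_mul_pow_le (adj := adj) b U' U k r
        have hprod : U.card ^ k ≤ 2 ^ (e * k) * ∏ u ∈ Y (Sum.inr w), (C' u).card := by
          calc U.card ^ k = ∏ u ∈ Y (Sum.inr w), U.card := by rw [Finset.prod_const]
            _ ≤ ∏ u ∈ Y (Sum.inr w), (2 ^ e * (C' u).card) :=
              Finset.prod_le_prod' fun u hu => by
                rw [hC'A u (hYA u hu)]; exact hCcard u (hYA u hu)
            _ = _ := by
              rw [Finset.prod_mul_distrib, Finset.prod_const, ← pow_mul]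
        -- The candidate sets fill a proportion 2 ^ (-e) of `U`, so the weighted density is at most
        -- 2 ^ ((e + 1) k) times that of sparse `k`-tuples in `U`. Passing to `q`-tuples, `hsparse`
        -- and 8 D ≤ 2 ^ δ bound it by 1/(4 D); at most `D` such `w` involve `v`.
        have hmain : 4 * D * 2 ^ k * N ≤ ∏ u ∈ Y (Sum.inr w), (C' u).card := by
          have e1 : 8 * D * 2 ^ ((e + 1) * k) * (N * U.card ^ r) ≤ 2 * U.card ^ (k + r) := by
            refine le_trans ?_ hsparse
            refine Nat.mul_le_mul (Nat.mul_le_mul hδ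
              (Nat.pow_le_pow_right (by norm_num) (Nat.mul_le_mul_left _ hk)))
              ((Nat.mul_le_mul_right _ hv1).trans hv2)
          have e2 : (2 * 2 ^ (e * k) * U.card ^ r) * (4 * D * 2 ^ k * N) ≤
              (2 * 2 ^ (e * k) * U.card ^ r) * ∏ u ∈ Y (Sum.inr w), (C' u).card := by
            calc _ = 8 * D * 2 ^ ((e + 1) * k) * (N * U.card ^ r) := by ring
              _ ≤ 2 * U.card ^ (k + r) := e1
              _ = 2 * U.card ^ r * U.card ^ k := by ring
              _ ≤ 2 * U.card ^ r * (2 ^ (e * k) * ∏ u ∈ Y (Sum.inr w), (C' u).card) :=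
                Nat.mul_le_mul_left _ hprod
              _ = _ := by ring
          exact Nat.le_of_mul_le_mul_left e2 (by positivity)
        have hmain' : 4 * (D : ℝ) * 2 ^ k * N ≤ ∏ u ∈ Y (Sum.inr w), ((C' u).card : ℝ) := by
          exact_mod_cast hmain
        have hQ : (0 : ℝ) < ∏ u ∈ Y (Sum.inr w), ((C' u).card : ℝ) :=
          Finset.prod_pos fun u _ => hpos u
        change (N : ℝ) / (∏ u ∈ Y (Sum.inr w), ((C' u).card : ℝ)) * 2 ^ k ≤ _
        rw [div_mul_eq_mul_div, div_le_div_iff₀ hQ (by positivity)]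
        linarith
      calc _ ≤ ∑ w ∈ s₂, (if G.Adj v w then 1 / (4 * (D : ℝ)) else 0) :=
            Finset.sum_le_sum hterm
        _ = ((s₂.filter fun w => G.Adj v w).card : ℝ) * (1 / (4 * (D : ℝ))) := by
            rw [← Finset.sum_filter, Finset.sum_const, nsmul_eq_mul]
        _ ≤ (D : ℝ) * (1 / (4 * (D : ℝ))) := by
            have : (s₂.filter fun w => G.Adj v w).card ≤ D := by
              refine le_trans ?_ (hout v)
              rw [outDegree, Set.ncard_eq_toFinset_card']
              refine Finset.card_le_card fun w hw => ?_
              simpa using (Finset.mem_filter.1 hw).2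
            gcongr
        _ = _ := by field_simp
    linarith
  obtain ⟨g, hgC, hg⟩ := exists_satisfying_assignment (C := C') (z := z) (s := s₁.disjSum s₂)
    (Y := Y) (bad := bad) hdep hYne hC'ne hden
  refine ⟨g, fun v hv => hC'A v hv ▸ hgC v, fun u hu v hv huv => ?_, fun w hw => ?_⟩
  · by_contra hne
    exact hg (Sum.inl (u, v)) (by simp [hs₁, hu, hv, hne]) huv
  · by_cases hne : (inN w).Nonempty
    · have := hg (Sum.inr w) (by simp [hs₂, hw, hne])
      simp only [hbad, Sum.elim_inr, not_lt] at this
      rwa [mul_comm]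
    · rw [candidates_of_no_inNeighbors g U' fun v hv => hne ⟨v, by simpa [hinN] using hv⟩]
      exact Nat.le_mul_of_pos_left _ (by positivity)

end Embedding

/-! ### Embedding all layers -/

section Layers

open scoped Classical

variable {V W : Type*} {G : Digraph V} {H : ℕ} {P : ℕ → Finset V}

lemma IsGradedPartition.eq_of_mem (hP : IsGradedPartition G H P) {i j : ℕ} {v : V}
    (hi : 1 ≤ i) (hi' : i ≤ H) (hj : 1 ≤ j) (hj' : j ≤ H) (hvi : v ∈ P i) (hvj : v ∈ P j) :
    i = j := by
  by_contra hne
  exact Finset.disjoint_left.1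
    (hP.disjoint i (Finset.mem_Icc.2 ⟨hi, hi'⟩) j (Finset.mem_Icc.2 ⟨hj, hj'⟩) hne) hvi hvj

lemma IsGradedPartition.mem_of_adj (hP : IsGradedPartition G H P) {i : ℕ} {u v : V}
    (hi : 1 ≤ i) (hi' : i ≤ H) (hv : v ∈ P i) (huv : G.Adj u v) : 2 ≤ i ∧ u ∈ P (i - 1) := by
  obtain ⟨j, hj, hjH, hu, hv'⟩ := hP.edge u v huv
  have := hP.eq_of_mem hi hi' (by omega) (by omega) hv hv'
  subst this
  exact ⟨by omega, by simpa using hu⟩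

variable [Fintype V]

/-- The number of vertices of `A` with an in-neighbour. -/
noncomputable def nonSources (G : Digraph V) (A : Finset V) : ℕ :=
  (A.filter fun w => ∃ v, G.Adj v w).card

/-- The number of vertices of `A` without in-neighbours. -/
noncomputable def sources (G : Digraph V) (A : Finset V) : ℕ :=
  (A.filter fun w => ¬ ∃ v, G.Adj v w).card

lemma nonSources_add_sources (A : Finset V) : nonSources G A + sources G A = A.card :=
  Finset.card_filter_add_card_filter_not _

/-- Every vertex counted is an out-neighbour of the preceding layer, and the first layer has none.
This allows its cost to be charged to that layer. -/
lemma IsGradedPartition.nonSources_le (hP : IsGradedPartition G H P) {D : ℕ}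
    (hout : ∀ v, outDegree G v ≤ D) {i : ℕ} (hi : 1 ≤ i) (hi' : i ≤ H) :
    nonSources G (P i) ≤ D * if 2 ≤ i then (P (i - 1)).card else 0 := by
  split_ifs with h
  · rw [mul_comm]
    have hsub : ((P i).filter fun w => ∃ v, G.Adj v w) ⊆
        (P (i - 1)).biUnion fun v => Finset.univ.filter fun w => G.Adj v w := by
      intro w hw
      obtain ⟨hw, v, hv⟩ := Finset.mem_filter.1 hw
      rw [Finset.mem_biUnion]
      exact ⟨v, (hP.mem_of_adj hi hi' hw hv).2, by simpa using hv⟩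
    refine (Finset.card_le_card hsub).trans (Finset.card_biUnion_le_card_mul _ _ _ ?_)
    intro v _
    refine le_trans (le_of_eq ?_) (hout v)
    rw [outDegree, Set.ncard_eq_toFinset_card']
    congr 1; ext w; simp
  · have : (P i).filter (fun w => ∃ v, G.Adj v w) = ∅ := by
      refine Finset.filter_eq_empty_iff.2 fun w hw ⟨v, hv⟩ => h ?_
      exact (hP.mem_of_adj hi hi' hw hv).1
    rw [nonSources, this]; simp

/-- A source has all of `U` as candidates and contributes 1/|U|, any other vertex at most 2 ^ e/|U|.
Hence only non-sources carry the weight 2 ^ e in the size required of `U`. -/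
lemma sum_one_div_card_candidates_le {adj : W → W → Prop} (f : V → W) (A : Finset V)
    (U : Finset W) (e : ℕ)
    (hU : 16 * (2 ^ e * nonSources G A + sources G A) ≤ U.card) (hUpos : 0 < U.card)
    (hC : ∀ v ∈ A, U.card ≤ 2 ^ e * (candidates G adj f U v).card) :
    ∑ v ∈ A, (1 : ℝ) / (candidates G adj f U v).card ≤ 1 / 16 := by
  have hU0 : (0 : ℝ) < U.card := by exact_mod_cast hUpos
  rw [← Finset.sum_filter_add_sum_filter_not A (fun w => ∃ v, G.Adj v w)]
  have h1 : ∑ v ∈ A.filter (fun w => ∃ v, G.Adj v w),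
      (1 : ℝ) / (candidates G adj f U v).card ≤ nonSources G A * (2 ^ e / U.card) := by
    rw [nonSources, ← nsmul_eq_mul]
    refine Finset.sum_le_card_nsmul _ _ _ fun v hv => ?_
    have h := hC v (Finset.mem_filter.1 hv).1
    have hpos : 0 < (candidates G adj f U v).card := by
      by_contra h0
      have : (candidates G adj f U v).card = 0 := by omega
      rw [this] at h; omega
    have hpos' : (0 : ℝ) < (candidates G adj f U v).card := by exact_mod_cast hpos
    rw [div_le_div_iff₀ hpos' hU0, one_mul]
    exact_mod_cast h
  have h2 : ∑ v ∈ A.filter (fun w => ¬ ∃ v, G.Adj v w),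
      (1 : ℝ) / (candidates G adj f U v).card ≤ sources G A * (1 / U.card) := by
    rw [sources, ← nsmul_eq_mul]
    refine Finset.sum_le_card_nsmul _ _ _ fun v hv => ?_
    rw [candidates_of_no_inNeighbors f U fun u hu => (Finset.mem_filter.1 hv).2 ⟨u, hu⟩]
  have h3 : (nonSources G A : ℝ) * (2 ^ e / U.card) + sources G A * (1 / U.card) =
      (2 ^ e * nonSources G A + sources G A) / U.card := by ring
  have h4 : ((2 : ℝ) ^ e * nonSources G A + sources G A) / U.card ≤ 1 / 16 := by
    rw [div_le_div_iff₀ hU0 (by norm_num)]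
    have : (16 : ℝ) * (2 ^ e * nonSources G A + sources G A) ≤ U.card := by exact_mod_cast hU
    linarith
  linarith

/-- A digraph with a graded partition embeds into a chain of sets with few sparse tuples. -/
theorem IsGradedPartition.exists_embedding (hP : IsGradedPartition G H P)
    {adj : W → W → Prop} (f₀ : V → W) (q : ℕ → ℕ) (D δ : ℕ) (hD : 1 ≤ D) (hδ : 8 * D ≤ 2 ^ δ)
    (hout : ∀ v, outDegree G v ≤ D)
    (hin : ∀ i, 1 ≤ i → i < H → ∀ w ∈ P (i + 1), inDegree G w ≤ q i)
    (U : ℕ → Finset W)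
    (hdisj : ∀ i, 1 ≤ i → i ≤ H → ∀ j, 1 ≤ j → j ≤ H → i ≠ j → Disjoint (U i) (U j))
    (hU : ∀ i, 1 ≤ i → i ≤ H →
      16 * (2 ^ sparsity (q (i - 1 - 1)) (q (i - 1)) * nonSources G (P i) + sources G (P i)) ≤
        (U i).card)
    (hsparse : ∀ i, 1 ≤ i → i ≤ H →
      2 ^ δ * 2 ^ ((sparsity (q (i - 1 - 1)) (q (i - 1)) + 1) * q i) *
        (sparseTuples adj (sparsity (q (i - 1)) (q i)) (U (i + 1)) (U i) (q i)).card ≤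
          2 * (U i).card ^ q i) :
    ∃ f : V → W, Function.Injective f ∧ ∀ u v, G.Adj u v → adj (f u) (f v) := by
  have key : ∀ k, k ≤ H → ∃ f : V → W,
      (∀ i, 1 ≤ i → i ≤ k → ∀ v ∈ P i, f v ∈ U i) ∧
      (∀ i, 1 ≤ i → i ≤ k → ∀ u ∈ P i, ∀ v ∈ P i, f u = f v → u = v) ∧
      (∀ i, 1 ≤ i → i ≤ k → ∀ v ∈ P i, ∀ u, G.Adj u v → adj (f u) (f v)) ∧
      (k < H → ∀ w ∈ P (k + 1), (U (k + 1)).card ≤ 2 ^ sparsity (q (k - 1)) (q k) *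
        (candidates G adj f (U (k + 1)) w).card) := by
    intro k
    induction k with
    | zero =>
      intro _
      refine ⟨f₀, ?_, ?_, ?_, fun hH w hw => ?_⟩
      · intro i _ _; omega
      · intro i _ _; omega
      · intro i _ _; omega
      -- The first layer consists of sources, so the arbitrary map `f₀` imposes nothing.
      · rw [candidates_of_no_inNeighbors f₀ _ fun v hv => by
          have := (hP.mem_of_adj le_rfl hH hw hv).1
          omega]
        exact Nat.le_mul_of_pos_left _ (by positivity)
    | succ k ih =>
      intro hk
      obtain ⟨f, hf1, hf2, hf3, hf4⟩ := ih (by omega)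
      have hcand := hf4 (by omega)
      have hUk := hU (k + 1) (by omega) hk
      have hsk := hsparse (k + 1) (by omega) hk
      simp only [Nat.add_sub_cancel] at hUk hsk
      set e := sparsity (q (k - 1)) (q k) with he
      have hpos : (P (k + 1)).Nonempty → 0 < (U (k + 1)).card := by
        intro hne
        have h1 := hne.card_pos
        have h2 := nonSources_add_sources (G := G) (P (k + 1))
        have h3 : nonSources G (P (k + 1)) ≤ 2 ^ e * nonSources G (P (k + 1)) :=
          Nat.le_mul_of_pos_left _ (by positivity)
        omega
      have hBA : ∀ w ∈ (if k + 1 < H then P (k + 2) else ∅), ∀ v, G.Adj v w →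
          v ∈ P (k + 1) := by
        intro w hw v hv
        split_ifs at hw with h
        · exact (hP.mem_of_adj (by omega) h hw hv).2
        · simp at hw
      obtain ⟨g, hg1, hg2, hg3⟩ := exists_layer_embedding (adj := adj) G f₀
        (candidates G adj f (U (k + 1))) (U (k + 1)) (U (k + 2)) (P (k + 1))
        (if k + 1 < H then P (k + 2) else ∅) (q (k + 1)) e (sparsity (q k) (q (k + 1))) D δ hD hδ
        (fun v _ => Finset.filter_subset _ _) hcand
        (fun v hv => by
          rw [← Finset.card_pos]
          have h := hcand v hv
          have h2 := hpos ⟨v, hv⟩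
          by_contra h0
          have : (candidates G adj f (U (k + 1)) v).card = 0 := by omega
          rw [this] at h; omega)
        (by
          rcases (P (k + 1)).eq_empty_or_nonempty with h | h
          · rw [h]; simp
          · exact sum_one_div_card_candidates_le f _ _ e hUk (hpos h) hcand)
        hBA
        (fun w hw => by
          split_ifs at hw with h
          · exact hin (k + 1) (by omega) h w hw
          · simp at hw)
        hout hsk
      have hnew : ∀ v ∈ P (k + 1), (if v ∈ P (k + 1) then g v else f v) = g v :=
        fun v hv => if_pos hv
      have hold : ∀ i, 1 ≤ i → i ≤ k → ∀ v ∈ P i, (if v ∈ P (k + 1) then g v else f v) = f v := by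
        intro i hi hik v hv
        refine if_neg fun hv' => ?_
        have := hP.eq_of_mem hi (by omega) (by omega) hk hv hv'
        omega
      refine ⟨fun v => if v ∈ P (k + 1) then g v else f v, ?_, ?_, ?_, ?_⟩
      · intro i hi hik v hv
        rcases Nat.le_succ_iff.1 hik with h | rfl
        · simp only [hold i hi h v hv]; exact hf1 i hi h v hv
        · simp only [hnew v hv]; exact (Finset.mem_filter.1 (hg1 v hv)).1
      · intro i hi hik u hu v hv huv
        rcases Nat.le_succ_iff.1 hik with h | rfl
        · simp only [hold i hi h v hv, hold i hi h u hu] at huv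
          exact hf2 i hi h u hu v hv huv
        · simp only [hnew v hv, hnew u hu] at huv
          exact hg2 u hu v hv huv
      · intro i hi hik v hv u huv
        obtain ⟨hi2, hu⟩ := hP.mem_of_adj hi (by omega) hv huv
        simp only [hold (i - 1) (by omega) (by omega) u hu]
        rcases Nat.le_succ_iff.1 hik with h | rfl
        · simp only [hold i hi h v hv]; exact hf3 i hi h v hv u huv
        · simp only [hnew v hv]
          exact (Finset.mem_filter.1 (hg1 v hv)).2 u huv
      · intro hkH w hw
        have h := hg3 w (by rw [if_pos hkH]; exact hw)
        refine h.trans (le_of_eq ?_)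
        rw [candidates_congr (U (k + 2)) fun v hv => (hnew v (hBA w (by
          rw [if_pos hkH]; exact hw) v hv)).symm]
        rfl
  obtain ⟨f, hf1, hf2, hf3, -⟩ := key H le_rfl
  refine ⟨f, fun u v huv => ?_, fun u v huv => ?_⟩
  · obtain ⟨i, hi, hu⟩ := hP.cover u
    obtain ⟨j, hj, hv⟩ := hP.cover v
    rw [Finset.mem_Icc] at hi hj
    by_cases hij : i = j
    · subst hij
      exact hf2 i hi.1 hi.2 u hu v hv huv
    · have h := Finset.disjoint_left.1 (hdisj i hi.1 hi.2 j hj.1 hj.2 hij)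
        (hf1 i hi.1 hi.2 u hu)
      rw [huv] at h
      exact absurd (hf1 j hj.1 hj.2 v hv) h
  · obtain ⟨j, hj, hv⟩ := hP.cover v
    rw [Finset.mem_Icc] at hj
    exact hf3 j hj.1 hj.2 v hv u huv

/-- A tournament contains every digraph with a graded partition whose layers are small compared to
the number of vertices. -/
theorem IsGradedPartition.containsCopy (hP : IsGradedPartition G H P) {N : ℕ}
    {T : Digraph (Fin N)} (hT : IsTournament T) (hN : 0 < N) (q : ℕ → ℕ) (d D : ℕ)
    (hd : 1 ≤ d) (hD : 1 ≤ D) (hq : ∀ i, q i ≤ d) (hout : ∀ v, outDegree G v ≤ D)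
    (hin : ∀ i, 1 ≤ i → i < H → ∀ w ∈ P (i + 1), inDegree G w ≤ q i)
    (hne : ∀ i, 1 ≤ q i → i < H ∧ (P (i + 1)).Nonempty)
    (hlen : 10 ^ 9 * d ^ 2 * D *
      ∑ i ∈ Finset.Icc 1 H, 2 ^ (2 * (q (i - 1) + q i)) * (P i).card ≤ N) :
    ContainsCopy T G := by
  -- 2 ^ δ is the least power of 2 that is at least 8 D.
  obtain ⟨δ, hδ1, hδ2⟩ : ∃ δ, 8 * D ≤ 2 ^ δ ∧ 2 ^ δ ≤ 16 * D := by
    refine ⟨Nat.clog 2 (8 * D), Nat.le_pow_clog (by norm_num) _, ?_⟩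
    have h := Nat.pow_pred_clog_lt_self (b := 2) (by norm_num) (x := 8 * D) (by omega)
    have h0 : 0 < Nat.clog 2 (8 * D) := Nat.clog_pos (by norm_num) (by omega)
    obtain ⟨m, hm⟩ : ∃ m, Nat.clog 2 (8 * D) = m + 1 := ⟨_, (Nat.succ_pred_eq_of_pos h0).symm⟩
    rw [hm] at h ⊢
    rw [Nat.pred_succ] at h
    rw [pow_succ]; omega
  -- `P` is arbitrary outside 1, …, H, while `n` refers to the indices 0 and H + 1 as well; these
  -- must count as empty.
  set c : ℕ → ℕ := fun i => if 1 ≤ i ∧ i ≤ H then (P i).card else 0 with hc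
  set X : ℕ → ℕ := fun i => 2 ^ (2 * (q (i - 1) + q i)) * c i with hX
  set n : ℕ → ℕ := fun i => 2 ^ 20 * D * (X i + X (i - 1)) with hn
  set u : ℕ → ℕ := fun i => if i ≤ H then
    16 * (2 ^ sparsity (q (i - 1 - 1)) (q (i - 1)) * nonSources G (P i) + sources G (P i))
    else 0 with hu
  obtain ⟨l, hnd, hlcard, hmed⟩ := exists_isMedianOrder (adj := T.Adj) fun a b hab h => by
    by_contra h'
    exact h ((hT.2 a b hab).2 h')
  have hsum : ∑ i ∈ Finset.Ico 1 (H + 1), 14 * d * (n i + n (i + 1)) ≤ l.length := by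
    have hS : ∑ i ∈ Finset.range (H + 2), X i =
        ∑ i ∈ Finset.Icc 1 H, 2 ^ (2 * (q (i - 1) + q i)) * (P i).card := by
      symm
      refine (Finset.sum_congr rfl fun i hi => ?_).trans (Finset.sum_subset (fun i hi => ?_) ?_)
      · rw [Finset.mem_Icc] at hi
        simp only [hX, hc]
        rw [if_pos hi]
      · rw [Finset.mem_Icc] at hi
        rw [Finset.mem_range]; omega
      · intro i _ hi
        rw [Finset.mem_Icc] at hi
        simp only [hX, hc]
        rw [if_neg hi, mul_zero]
    set S := ∑ i ∈ Finset.range (H + 2), X i with hSdef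
    have s1 : ∑ i ∈ Finset.Ico 1 (H + 1), X i ≤ S :=
      Finset.sum_le_sum_of_subset fun i hi => by
        rw [Finset.mem_Ico] at hi; rw [Finset.mem_range]; omega
    have s2 : ∑ i ∈ Finset.Ico 1 (H + 1), X (i - 1) ≤ S := by
      rw [Finset.sum_Ico_eq_sum_range]
      simp only [Nat.add_sub_cancel, Nat.add_sub_cancel_left]
      exact Finset.sum_le_sum_of_subset (Finset.range_subset_range.2 (by omega))
    have s3 : ∑ i ∈ Finset.Ico 1 (H + 1), X (i + 1) ≤ S := by
      rw [Finset.sum_Ico_add' X 1 (H + 1) 1]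
      exact Finset.sum_le_sum_of_subset fun i hi => by
        rw [Finset.mem_Ico] at hi; rw [Finset.mem_range]; omega
    have hexp : ∑ i ∈ Finset.Ico 1 (H + 1), 14 * d * (n i + n (i + 1)) =
        14 * d * (2 ^ 20 * D) * (2 * (∑ i ∈ Finset.Ico 1 (H + 1), X i) +
          ∑ i ∈ Finset.Ico 1 (H + 1), X (i - 1) + ∑ i ∈ Finset.Ico 1 (H + 1), X (i + 1)) := by
      rw [Finset.mul_sum _ _ 2, ← Finset.sum_add_distrib, ← Finset.sum_add_distrib, Finset.mul_sum]
      refine Finset.sum_congr rfl fun i _ => ?_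
      simp only [hn, Nat.add_sub_cancel]
      ring
    rw [hlcard, Fintype.card_fin]
    refine le_trans ?_ hlen
    rw [hexp, ← hS]
    -- The constant is 14 · 2 ^ 20 · 4 = 58720256; one of the two factors `d` is to spare.
    calc _ ≤ 14 * d * (2 ^ 20 * D) * (4 * S) := Nat.mul_le_mul_left _ (by omega)
      _ = 58720256 * d * 1 * D * S := by ring
      _ ≤ 10 ^ 9 * d * d * D * S := by gcongr; norm_num
      _ = _ := by ring
  obtain ⟨U, hdisj, hU⟩ := hmed.exists_chain hnd (14 * d) H (by omega) n u
    (by simp [hu])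
    (fun i U U' => 2 ^ δ * 2 ^ ((sparsity (q (i - 1 - 1)) (q (i - 1)) + 1) * q i) *
        (sparseTuples T.Adj (sparsity (q (i - 1)) (q i)) U' U (q i)).card ≤ 2 * U.card ^ q i)
    (by
      intro i hi hiH I U' hI hU' hdens
      have hci : c i = (P i).card := if_pos ⟨hi, hiH⟩
      have hci' : (if 2 ≤ i then (P (i - 1)).card else 0) = c (i - 1) := by
        simp only [hc]
        by_cases h : 2 ≤ i
        · rw [if_pos h, if_pos (by omega)]
        · rw [if_neg h, if_neg (by omega)]
      have hnp := hP.nonSources_le hout hi hiH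
      rw [hci'] at hnp
      have hns := nonSources_add_sources (G := G) (P i)
      rw [← hci] at hns
      have hui : u i = 16 * (2 ^ sparsity (q (i - 1 - 1)) (q (i - 1)) * nonSources G (P i) +
        sources G (P i)) := if_pos hiH
      rw [hui]
      refine exists_subset_of_dense hd (hq _) (hq _) hδ2 hnp hns hD I U' hI (fun hqi => ?_) hdens
      -- The random vertices are drawn from `U'`, which is nonempty because the next layer is.
      obtain ⟨hiH', hPne⟩ := hne i hqi
      rw [← Finset.card_pos]
      refine lt_of_lt_of_le ?_ hU'
      have hui' : u (i + 1) = 16 * (2 ^ sparsity (q (i - 1)) (q i) * nonSources G (P (i + 1)) +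
        sources G (P (i + 1))) := if_pos hiH'
      have h1 := hPne.card_pos
      have h2 := nonSources_add_sources (G := G) (P (i + 1))
      have h3 : nonSources G (P (i + 1)) ≤
          2 ^ sparsity (q (i - 1)) (q i) * nonSources G (P (i + 1)) :=
        Nat.le_mul_of_pos_left _ (by positivity)
      rw [hui']
      omega)
    hsum
  exact hP.exists_embedding (fun _ => ⟨0, hN⟩) q D δ hD hδ1 hout hin U hdisj
    (fun i hi hiH => by
      have := (hU i hi hiH).1
      rwa [show u i = _ from if_pos hiH] at this)
    (fun i hi hiH => (hU i hi hiH).2)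

end Layers

/-! ### In-degrees between consecutive layers -/

section LayerDegrees

variable {V : Type*} [Fintype V] {G : Digraph V} {H : ℕ} {P : ℕ → Finset V}

lemma inDegree_le_maxInDegree (G : Digraph V) (v : V) : inDegree G v ≤ maxInDegree G :=
  Finset.le_sup (f := inDegree G) (Finset.mem_univ v)

lemma outDegree_le_maxOutDegree (G : Digraph V) (v : V) : outDegree G v ≤ maxOutDegree G :=
  Finset.le_sup (f := outDegree G) (Finset.mem_univ v)

lemma inDegree_induced_le (S : Finset V) (v : S) : inDegree (induced G S) v ≤ inDegree G v := by
  refine Set.ncard_le_ncard_of_injOn (fun u : S => (u : V)) (fun u hu => hu)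
    Subtype.val_injective.injOn (Set.toFinite _)

lemma layerMaxInDegree_le [DecidableEq V] (i : ℕ) : layerMaxInDegree G H P i ≤ maxInDegree G := by
  unfold layerMaxInDegree
  split_ifs
  · exact Finset.sup_le fun v _ => (inDegree_induced_le _ v).trans (inDegree_le_maxInDegree G v)
  · exact Nat.zero_le _

/-- All in-neighbours of a vertex of `P (i + 1)` lie in `P i`, so none is lost in the induced
subdigraph. -/
lemma IsGradedPartition.inDegree_le_layerMaxInDegree [DecidableEq V]
    (hP : IsGradedPartition G H P) {i : ℕ}
    (hi : 1 ≤ i) (hiH : i < H) {w : V} (hw : w ∈ P (i + 1)) :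
    inDegree G w ≤ layerMaxInDegree G H P i := by
  rw [layerMaxInDegree, if_pos ⟨hi, hiH⟩]
  refine le_trans ?_ (inDegree_le_maxInDegree _ ⟨w, Finset.mem_union_right _ hw⟩)
  have hmem : ∀ u, G.Adj u w → u ∈ P i ∪ P (i + 1) := fun u hu =>
    Finset.mem_union_left _ (by simpa using (hP.mem_of_adj (by omega) hiH hw hu).2)
  refine Set.ncard_le_ncard_of_injOn
    (fun u => if h : u ∈ P i ∪ P (i + 1) then ⟨u, h⟩ else ⟨w, Finset.mem_union_right _ hw⟩)
    (fun u hu => ?_) (fun u hu u' hu' h => ?_) (Set.toFinite _)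
  · have := hmem u hu
    simp only [this, dif_pos]
    exact hu
  · simp only [hmem u hu, hmem u' hu', dif_pos, Subtype.mk.injEq] at h
    exact h

lemma IsGradedPartition.nonempty_of_layerMaxInDegree_pos [DecidableEq V]
    (hP : IsGradedPartition G H P) {i : ℕ}
    (h : 1 ≤ layerMaxInDegree G H P i) : i < H ∧ (P (i + 1)).Nonempty := by
  unfold layerMaxInDegree at h
  split_ifs at h with hi
  · refine ⟨hi.2, ?_⟩
    obtain ⟨w, -, hw⟩ := (Finset.lt_sup_iff (f := inDegree (induced G (P i ∪ P (i + 1))))).1 h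
    obtain ⟨u, hu⟩ := (Set.ncard_pos (Set.toFinite _)).1 hw
    have hadj : G.Adj u w := hu
    rcases Finset.mem_union.1 w.2 with hwi | hwi
    · have h1 := hP.mem_of_adj hi.1 hi.2.le hwi hadj
      -- An edge inside the union cannot end in `P i`, but for `u ∈ P (i + 1)` no contradiction is
      -- needed: `u` is itself a witness.
      rcases Finset.mem_union.1 u.2 with hui | hui
      · have := hP.eq_of_mem (by omega) (by omega) hi.1 hi.2.le h1.2 hui
        omega
      · exact ⟨u, hui⟩
    · exact ⟨w, hwi⟩
  · omega

lemma one_le_maxInDegree_of_adj {u v : V} (h : G.Adj u v) : 1 ≤ maxInDegree G :=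
  le_trans ((Set.ncard_pos (Set.toFinite _)).2 ⟨u, h⟩) (inDegree_le_maxInDegree G v)

lemma one_le_maxOutDegree_of_adj {u v : V} (h : G.Adj u v) : 1 ≤ maxOutDegree G :=
  le_trans ((Set.ncard_pos (Set.toFinite _)).2 ⟨v, h⟩) (outDegree_le_maxOutDegree G u)

end LayerDegrees

end OrientedRamsey

theorem theorem3p1 {V : Type*} [Fintype V] [DecidableEq V] (G : Digraph V) (H : ℕ)
    (P : ℕ → Finset V) (hP : OrientedRamsey.IsGradedPartition G H P)
    (hG : ∃ u v, G.Adj u v) :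
    OrientedRamsey.orientedRamseyNumber G ≤
      ((10 ^ 9 * OrientedRamsey.maxInDegree G ^ 2 * OrientedRamsey.maxOutDegree G *
        ∑ i ∈ Finset.Icc 1 H,
          2 ^ (2 * (OrientedRamsey.layerMaxInDegree G H P (i - 1) +
            OrientedRamsey.layerMaxInDegree G H P i)) * (P i).card : ℕ) : ℕ∞) := by
  obtain ⟨u, v, huv⟩ := hG
  have hd := OrientedRamsey.one_le_maxInDegree_of_adj huv
  have hD := OrientedRamsey.one_le_maxOutDegree_of_adj huv
  refine iInf₂_le _ fun T hT => ?_
  refine hP.containsCopy hT ?_ (OrientedRamsey.layerMaxInDegree G H P)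
    (OrientedRamsey.maxInDegree G) (OrientedRamsey.maxOutDegree G) hd hD
    OrientedRamsey.layerMaxInDegree_le (OrientedRamsey.outDegree_le_maxOutDegree G)
    (fun i hi hiH w hw => hP.inDegree_le_layerMaxInDegree hi hiH hw)
    (fun i hi => hP.nonempty_of_layerMaxInDegree_pos hi) le_rfl
  -- It remains to see that the tournament has a vertex; the layer of `u` makes the bound positive.
  obtain ⟨i, hi, hui⟩ := hP.cover u
  refine Nat.mul_pos (by positivity) (lt_of_lt_of_le ?_ (Finset.single_le_sum
    (f := fun i => 2 ^ (2 * (OrientedRamsey.layerMaxInDegree G H P (i - 1) +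
      OrientedRamsey.layerMaxInDegree G H P i)) * (P i).card) (fun _ _ => Nat.zero_le _) hi))
  exact Nat.mul_pos (by positivity) (Finset.card_pos.2 ⟨u, hui⟩)
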